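/- Setting. Let $\mathcal U_1,\mathcal U_2,\mathcal X_1,\mathcal X_2,\mathcal Y$ be finite alphabets, $P_{U_1},P_{U_2}$ probability distributions on $\mathcal U_1,\mathcal U_2$ (two independent memoryless sources), $W(y|x_1,x_2)$ the transition probability of a discrete memoryless multiple-access channel, and, for $\nu=1,2$, let $Q_{\nu,1},Q_{\nu,2}$ be probability distributions on $\mathcal X_\nu$. A code of block length $n$ assigns to each message $\boldsymbol u_\nu\in\mathcal U_\nu^n$ a codeword $\boldsymbol x_\nu(\boldsymbol u_\nu)\in\mathcal X_\nu^n$; the decoder is the maximum a posteriori decoder, which returns a maximizer over $(\boldsymbol u_1,\boldsymbol u_2)$ of $P_{U_1}^n(\boldsymbol u_1)P_{U_2}^n(\boldsymbol u_2)W^n(\boldsymbol y|\boldsymbol x_1(\boldsymbol u_1),\boldsymbol x_2(\boldsymbol u_2))$ (ties broken arbitrarily); $\epsilon^n$ is the probability that the decoded pair is not the transmitted pair. An exponent $E$ is achievable if for some sequence of pairs of codebooks $\liminf_{n\to\infty}-\frac1n\log\epsilon^n\ge E$. Message-dependent random coding with thresholds $\gamma_1,\gamma_2\in[0,1]$: for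 user $\nu$ class $1$ consists of the messages with $P_{U_\nu}^n(\boldsymbol u_\nu)\ge\gamma_\nu^n$ and class $2$ of the others; all codewords are drawn independently, that of a message of class $i$ with i.i.d. letters of distribution $Q_{\nu,i}$. Let $\bar\epsilon^n$ be the average of $\epsilon^n$ over this ensemble. Functions. Let $$E_0(\rho,Q,V)=-\log\sum_z\Big(\sum_xQ(x)V(z|x)^{\frac1{1+\rho}}\Big)^{1+\rho},\qquad E_s(\rho,P)=\log\Big(\sum_{u}P(u)^{\frac1{1+\rho}}\Big)^{1+\rho},$$ where here and below sums, minima and maxima over source letters $u$ are over those with $P(u)>0$. For $\min_uP(u)\le\gamma\le\max_uP(u)$ let $\rho_\gamma$ be a solution of $$\frac{\sum_uP(u)^{\frac1{1+\rho}}\log P(u)}{\sum_uP(u)^{\frac1{1+\rho}}}=\log\gamma ,$$ and let $\ell(\rho)=E_s(\rho_\gamma,P)+E_s'(\rho_\gamma,P)(\rho-\rho_\gamma)$. The solution is read as a solution $t_\gamma=\frac1{1+\rho_\gamma}\in[-\infty,\infty]$, with $\ell$ defined by continuity when $t_\gamma=0$ and when $t_\gamma=\pm\infty$ (for a non-uniform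 $P$ at $\gamma=\max_u P(u)$, $\gamma=\min_u P(u)$, respectively); if $P$ is uniform, every $t$ is a solution and the choice does not matter. Put $$E_{s,1}(\rho,P,\gamma)=\begin{cases}E_s(\rho,P)&\frac1{1+\rho}\ge\frac1{1+\rho_\gamma}\\ \ell(\rho)&\text{otherwise,}\end{cases}\qquad E_{s,2}(\rho,P,\gamma)=\begin{cases}E_s(\rho,P)&\frac1{1+\rho}<\frac1{1+\rho_\gamma}\\ \ell(\rho)&\text{otherwise.}\end{cases}$$ For $\gamma<\min_uP(u)$ put $E_{s,1}=E_s$, $E_{s,2}=-\infty$; for $\gamma>\max_uP(u)$ put $E_{s,1}=-\infty$, $E_{s,2}=E_s$. For $i_1,i_2\in\{1,2\}$ and $\tau\in\{\{1\},\{2\},\{1,2\}\}$ let $$F_{\tau,i_\tau,i_{\tau^c}}(\gamma_1,\gamma_2)=\max_{\rho\in[0,1]}\Big[E_0(\rho,Q_{\tau,i_\tau},WQ_{\tau^c,i_{\tau^c}})-E_{s,i_\tau}(\rho,P_{U_\tau},\gamma_\tau)-E_{s,i_{\tau^c}}(0,P_{U_{\tau^c}},\gamma_{\tau^c})\Big].$$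 Here, for $\tau=\{1\}$ or $\{2\}$, $\tau^c$ is the other user and $WQ_{\tau^c,i}$ is the channel from $\mathcal X_\tau$ to $\mathcal X_{\tau^c}\times\mathcal Y$ with transition probability $W(y|x_1,x_2)Q_{\tau^c,i}(x_{\tau^c})$. For $\tau=\{1,2\}$, $Q_{\tau,i_\tau}(x_1,x_2)=Q_{1,i_1}(x_1)Q_{2,i_2}(x_2)$, the channel is $W$ from $\mathcal X_1\times\mathcal X_2$ to $\mathcal Y$, the second term is $E_{s,i_1}(\rho,P_{U_1},\gamma_1)+E_{s,i_2}(\rho,P_{U_2},\gamma_2)$, and the third term is absent. Proposition 1. For all $\gamma_1,\gamma_2\in[0,1]$ the average error probability of message-dependent random coding with MAP decoding satisfies $$\liminf_{n\to\infty}-\frac1n\log\bar\epsilon^n\ \ge\ \min_{\tau}\min_{i_\tau,i_{\tau^c}}F_{\tau,i_\tau,i_{\tau^c}}(\gamma_1,\gamma_2),$$ and $$E=\max_{\gamma_1,\gamma_2\in[0,1]}\ \min_{\tau}\ \min_{i_\tau,i_{\tau^c}}F_{\tau,i_\tau,i_{\tau^c}}(\gamma_1,\gamma_2)$$ is an achievable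 exponent. All the maxima (over $\rho$ and over $\gamma_1,\gamma_2$) are attained. -/

import Mathlib

open Filter Set

noncomputable section

namespace MAC

/-! ### Gallager's functions for a source and for a point-to-point channel -/

open Classical in
/-- The letters of positive probability of a source. -/
def supp {U : Type*} [Fintype U] (P : U → ℝ) : Finset U :=
  Finset.univ.filter (fun u => P u ≠ 0)

/-- Gallager's source function `E_s(ρ, P) = log (∑ᵤ P(u)^{1/(1+ρ)})^{1+ρ}`. -/
def Es {U : Type*} [Fintype U] (P : U → ℝ) (ρ : ℝ) : ℝ :=
  Real.log ((∑ u ∈ supp P, P u ^ (1 / (1 + ρ))) ^ (1 + ρ))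

/-- Gallager's channel function
`E_0(ρ, Q, V) = - log ∑_y (∑ₓ Q(x) V(y|x)^{1/(1+ρ)})^{1+ρ}`. -/
def E0 {X Z : Type*} [Fintype X] [Fintype Z] (ρ : ℝ) (Q : X → ℝ) (V : X → Z → ℝ) : ℝ :=
  -Real.log (∑ z, (∑ x, Q x * V x z ^ (1 / (1 + ρ))) ^ (1 + ρ))

/-! ### The modified source functions

The parameter `ρ_γ` of the threshold `γ` enters only through `t = 1 / (1 + ρ_γ)`, which ranges
over the extended reals; `t = 0` means `ρ_γ = ∞`, and `t = -∞, +∞` mean `ρ_γ = -1` from the left,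
from the right. -/

/-- Left-hand side of the implicit equation of `ρ_γ`, as a function of `t = 1 / (1 + ρ)`:
`(∑ᵤ P(u)^t log P(u)) / ∑ᵤ P(u)^t`. -/
def tiltedMean {U : Type*} [Fintype U] (P : U → ℝ) (t : ℝ) : ℝ :=
  (∑ u ∈ supp P, P u ^ t * Real.log (P u)) / ∑ u ∈ supp P, P u ^ t

/-- The tangent line `E_s(r) + E_s'(r) (ρ - r)` to `E_s` at `r = 1 / t - 1`; for `t = 0`, that is,
`r = ∞`, this is its limit, the asymptote of `E_s`. -/
def tangentLine {U : Type*} [Fintype U] (P : U → ℝ) (t ρ : ℝ) : ℝ :=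
  if t = 0 then
    (1 + ρ) * Real.log ((supp P).card : ℝ)
      + (∑ u ∈ supp P, Real.log (P u)) / ((supp P).card : ℝ)
  else Es P (1 / t - 1) + deriv (Es P) (1 / t - 1) * (ρ - (1 / t - 1))

open Classical in
/-- The limit of the tangent line as the threshold tends, from within the range of `P`, to an
end point `γ` (the smallest or the largest positive value of `P`). -/
def endLine {U : Type*} [Fintype U] (P : U → ℝ) (γ ρ : ℝ) : ℝ :=
  (1 + ρ) * Real.log ((Finset.univ.filter (fun u => P u = γ)).card : ℝ) + Real.log γ

open Classical in
/-- `E_{s,1}(ρ, P, γ)`. It is `E_s(ρ)` for `γ < min P` and `-∞` for `γ > max P`. In between it is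
`E_s(ρ)` if `1/(1+ρ) ≥ 1/(1+ρ_γ)` and the tangent line to `E_s` at `ρ_γ` otherwise. The implicit
equation has no real solution `t` only if `γ` is an end point of the range of a non-uniform `P`;
then `t = -∞` at `min P` and `t = +∞` at `max P`. If it has several solutions, then `P` is uniform,
and the value is the same for all of them. -/
def Es1 {U : Type*} [Fintype U] (ρ : ℝ) (P : U → ℝ) (γ : ℝ) : EReal :=
  if ∀ u, P u ≠ 0 → γ < P u then ((Es P ρ : ℝ) : EReal)
  else if ∀ u, P u < γ then ⊥
  else if h : ∃ t : ℝ, tiltedMean P t = Real.log γ then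
    if 1 / (1 + ρ) ≥ h.choose then ((Es P ρ : ℝ) : EReal)
    else ((tangentLine P h.choose ρ : ℝ) : EReal)
  else if ∀ u, P u ≠ 0 → γ ≤ P u then ((Es P ρ : ℝ) : EReal)
  else ((endLine P γ ρ : ℝ) : EReal)

open Classical in
/-- `E_{s,2}(ρ, P, γ)`. It is `-∞` for `γ < min P` and `E_s(ρ)` for `γ > max P`. In between it is
`E_s(ρ)` if `1/(1+ρ) < 1/(1+ρ_γ)` and the tangent line to `E_s` at `ρ_γ` otherwise, with the same
conventions as for `E_{s,1}`. -/
def Es2 {U : Type*} [Fintype U] (ρ : ℝ) (P : U → ℝ) (γ : ℝ) : EReal :=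
  if ∀ u, P u ≠ 0 → γ < P u then ⊥
  else if ∀ u, P u < γ then ((Es P ρ : ℝ) : EReal)
  else if h : ∃ t : ℝ, tiltedMean P t = Real.log γ then
    if 1 / (1 + ρ) < h.choose then ((Es P ρ : ℝ) : EReal)
    else ((tangentLine P h.choose ρ : ℝ) : EReal)
  else if ∀ u, P u ≠ 0 → γ ≤ P u then ((endLine P γ ρ : ℝ) : EReal)
  else ((Es P ρ : ℝ) : EReal)

/-- `E_{s,i}`. The classes 1 and 2 are indexed by `0` and `1` in `Fin 2`. -/
def Esi {U : Type*} [Fintype U] (i : Fin 2) (ρ : ℝ) (P : U → ℝ) (γ : ℝ) : EReal :=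
  if i = 0 then Es1 ρ P γ else Es2 ρ P γ

/-! ### The exponent -/

/-- The error types `τ = {1}`, `τ = {2}` and `τ = {1, 2}`. -/
inductive ErrType where
  | first : ErrType
  | second : ErrType
  | both : ErrType

section exponent

variable {U₁ U₂ X₁ X₂ Y : Type*} [Fintype U₁] [Fintype U₂] [Fintype X₁] [Fintype X₂] [Fintype Y]

/-- The function of `ρ` that is maximized in `F_{τ, i_τ, i_{τᶜ}}(γ₁, γ₂)`:
`E_0(ρ, Q_{τ,i_τ}, W Q_{τᶜ,i_{τᶜ}}) - E_{s,i_τ}(ρ, P_{U_τ}, γ_τ) - E_{s,i_{τᶜ}}(0, P_{U_{τᶜ}}, γ_{τᶜ})`.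
For `τ = {1}` and `τ = {2}`, `W Q_{τᶜ,i}` is the channel with transition probability
`W(y|x₁,x₂) Q_{τᶜ,i}(x_{τᶜ})` from `x_τ` to `(x_{τᶜ}, y)`; for `τ = {1,2}` the input distribution is
the product, the channel is `W`, the source term is the sum of those of the two users, and the
last term is absent. -/
def objective (P₁ : U₁ → ℝ) (P₂ : U₂ → ℝ) (Q₁ : Fin 2 → X₁ → ℝ) (Q₂ : Fin 2 → X₂ → ℝ)
    (W : X₁ → X₂ → Y → ℝ) (τ : ErrType) (i₁ i₂ : Fin 2) (γ₁ γ₂ ρ : ℝ) : EReal :=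
  match τ with
  | .first =>
      ((E0 ρ (Q₁ i₁) (fun (x₁ : X₁) (z : X₂ × Y) => W x₁ z.1 z.2 * Q₂ i₂ z.1) : ℝ) : EReal)
        - Esi i₁ ρ P₁ γ₁ - Esi i₂ 0 P₂ γ₂
  | .second =>
      ((E0 ρ (Q₂ i₂) (fun (x₂ : X₂) (z : X₁ × Y) => W z.1 x₂ z.2 * Q₁ i₁ z.1) : ℝ) : EReal)
        - Esi i₂ ρ P₂ γ₂ - Esi i₁ 0 P₁ γ₁
  | .both =>
      ((E0 ρ (fun x : X₁ × X₂ => Q₁ i₁ x.1 * Q₂ i₂ x.2)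
          (fun (x : X₁ × X₂) (y : Y) => W x.1 x.2 y) : ℝ) : EReal)
        - (Esi i₁ ρ P₁ γ₁ + Esi i₂ ρ P₂ γ₂)

/-- `F_{τ, i_τ, i_{τᶜ}}(γ₁, γ₂)`, the maximum over `ρ ∈ [0,1]`. -/
def F (P₁ : U₁ → ℝ) (P₂ : U₂ → ℝ) (Q₁ : Fin 2 → X₁ → ℝ) (Q₂ : Fin 2 → X₂ → ℝ)
    (W : X₁ → X₂ → Y → ℝ) (τ : ErrType) (i₁ i₂ : Fin 2) (γ₁ γ₂ : ℝ) : EReal :=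
  ⨆ ρ ∈ Icc (0 : ℝ) 1, objective P₁ P₂ Q₁ Q₂ W τ i₁ i₂ γ₁ γ₂ ρ

/-- `min_τ min_{i_τ, i_{τᶜ}} F_{τ, i_τ, i_{τᶜ}}(γ₁, γ₂)`. -/
def thresholdExponent (P₁ : U₁ → ℝ) (P₂ : U₂ → ℝ) (Q₁ : Fin 2 → X₁ → ℝ) (Q₂ : Fin 2 → X₂ → ℝ)
    (W : X₁ → X₂ → Y → ℝ) (γ₁ γ₂ : ℝ) : EReal :=
  ⨅ τ : ErrType, ⨅ i₁ : Fin 2, ⨅ i₂ : Fin 2, F P₁ P₂ Q₁ Q₂ W τ i₁ i₂ γ₁ γ₂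

/-- `E(P_U, W)`, the maximum over `γ₁, γ₂ ∈ [0,1]`. -/
def exponent (P₁ : U₁ → ℝ) (P₂ : U₂ → ℝ) (Q₁ : Fin 2 → X₁ → ℝ) (Q₂ : Fin 2 → X₂ → ℝ)
    (W : X₁ → X₂ → Y → ℝ) : EReal :=
  ⨆ γ₁ ∈ Icc (0 : ℝ) 1, ⨆ γ₂ ∈ Icc (0 : ℝ) 1, thresholdExponent P₁ P₂ Q₁ Q₂ W γ₁ γ₂

end exponent

/-! ### Codes, MAP decoding and the error probability -/

/-- The probability `∏ P(a_ℓ)` of a sequence under i.i.d. letters. -/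
def seqProb {A : Type*} (P : A → ℝ) {n : ℕ} (a : Fin n → A) : ℝ := ∏ l, P (a l)

/-- The memoryless channel `Wⁿ(y|x₁,x₂)`. -/
def chanProb {X₁ X₂ Y : Type*} (W : X₁ → X₂ → Y → ℝ) {n : ℕ}
    (x₁ : Fin n → X₁) (x₂ : Fin n → X₂) (y : Fin n → Y) : ℝ := ∏ l, W (x₁ l) (x₂ l) (y l)

/-- A codebook of block length `n`: a codeword for every source message. -/
abbrev Codebook (U X : Type*) (n : ℕ) := (Fin n → U) → (Fin n → X)

/-- A decoder of block length `n`. -/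
abbrev Decoder (U₁ U₂ Y : Type*) (n : ℕ) := (Fin n → Y) → (Fin n → U₁) × (Fin n → U₂)

section codes

variable {U₁ U₂ X₁ X₂ Y : Type*}

/-- The maximum a posteriori metric `Pⁿ(u₁,u₂) Wⁿ(y|x₁(u₁),x₂(u₂))` of a pair of messages. -/
def metric (P₁ : U₁ → ℝ) (P₂ : U₂ → ℝ) (W : X₁ → X₂ → Y → ℝ) {n : ℕ}
    (c₁ : Codebook U₁ X₁ n) (c₂ : Codebook U₂ X₂ n) (y : Fin n → Y)
    (u : (Fin n → U₁) × (Fin n → U₂)) : ℝ :=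
  seqProb P₁ u.1 * seqProb P₂ u.2 * chanProb W (c₁ u.1) (c₂ u.2) y

/-- The decoder returns a maximizer of the metric (ties are broken in any way). -/
def IsMAP (P₁ : U₁ → ℝ) (P₂ : U₂ → ℝ) (W : X₁ → X₂ → Y → ℝ) {n : ℕ}
    (c₁ : Codebook U₁ X₁ n) (c₂ : Codebook U₂ X₂ n) (d : Decoder U₁ U₂ Y n) : Prop :=
  ∀ y u, metric P₁ P₂ W c₁ c₂ y u ≤ metric P₁ P₂ W c₁ c₂ y (d y)

/-- MAP decoders exist. -/
theorem exists_isMAP [Finite U₁] [Finite U₂] [Nonempty U₁] [Nonempty U₂]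
    (P₁ : U₁ → ℝ) (P₂ : U₂ → ℝ) (W : X₁ → X₂ → Y → ℝ) {n : ℕ}
    (c₁ : Codebook U₁ X₁ n) (c₂ : Codebook U₂ X₂ n) :
    ∃ d : Decoder U₁ U₂ Y n, IsMAP P₁ P₂ W c₁ c₂ d := by
  choose d hd using fun y => Finite.exists_max (metric P₁ P₂ W c₁ c₂ y)
  exact ⟨d, hd⟩

variable [Fintype U₁] [Fintype U₂] [Fintype X₁] [Fintype X₂] [Fintype Y]

open Classical in
/-- The probability that the decoded pair of messages differs from the transmitted one. -/
def errorProb (P₁ : U₁ → ℝ) (P₂ : U₂ → ℝ) (W : X₁ → X₂ → Y → ℝ) {n : ℕ}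
    (c₁ : Codebook U₁ X₁ n) (c₂ : Codebook U₂ X₂ n) (d : Decoder U₁ U₂ Y n) : ℝ :=
  ∑ u₁ : Fin n → U₁, ∑ u₂ : Fin n → U₂, seqProb P₁ u₁ * seqProb P₂ u₂ *
    ∑ y : Fin n → Y, if d y ≠ (u₁, u₂) then chanProb W (c₁ u₁) (c₂ u₂) y else 0

/-- `-(1/n) log ε`, equal to `+∞` if `ε = 0`. -/
def decay (n : ℕ) (ε : ℝ) : EReal := (-ENNReal.log (ENNReal.ofReal ε)) / (n : EReal)

/-- `E` is an achievable exponent: for some sequence of pairs of codebooks, the error probability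
`εⁿ` of MAP decoding satisfies `liminf -(1/n) log εⁿ ≥ E`. -/
def IsAchievable (P₁ : U₁ → ℝ) (P₂ : U₂ → ℝ) (W : X₁ → X₂ → Y → ℝ) (E : EReal) : Prop :=
  ∃ (c₁ : ∀ n, Codebook U₁ X₁ n) (c₂ : ∀ n, Codebook U₂ X₂ n),
    ∀ d : ∀ n, Decoder U₁ U₂ Y n, (∀ n, IsMAP P₁ P₂ W (c₁ n) (c₂ n) (d n)) →
      E ≤ liminf (fun n => decay n (errorProb P₁ P₂ W (c₁ n) (c₂ n) (d n))) atTop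

/-! ### Message-dependent random coding -/

open Classical in
/-- The class of a message: class 1 if `Pⁿ(u) ≥ γⁿ`, class 2 if `Pⁿ(u) < γⁿ`. -/
def msgClass {U : Type*} (P : U → ℝ) (γ : ℝ) {n : ℕ} (u : Fin n → U) : Fin 2 :=
  if γ ^ n ≤ seqProb P u then 0 else 1

/-- The probability of a codebook in the ensemble: the codewords of different messages are
independent, and that of `u` is i.i.d. with the distribution `Q i`, where `i` is the class
of `u`. -/
def codebookProb {U X : Type*} [Fintype U] (P : U → ℝ) (Q : Fin 2 → X → ℝ)
    (γ : ℝ) {n : ℕ} (c : Codebook U X n) : ℝ :=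
  ∏ u : Fin n → U, seqProb (Q (msgClass P γ u)) (c u)

open Classical in
/-- The error probability averaged over the ensemble with thresholds `γ₁`, `γ₂`, the codebooks of
the two users being independent; `d c₁ c₂` is the decoder used with the codebooks `c₁`, `c₂`. -/
def avgErrorProb (P₁ : U₁ → ℝ) (P₂ : U₂ → ℝ) (Q₁ : Fin 2 → X₁ → ℝ) (Q₂ : Fin 2 → X₂ → ℝ)
    (W : X₁ → X₂ → Y → ℝ) (γ₁ γ₂ : ℝ) {n : ℕ}
    (d : Codebook U₁ X₁ n → Codebook U₂ X₂ n → Decoder U₁ U₂ Y n) : ℝ :=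
  ∑ c₁ : Codebook U₁ X₁ n, ∑ c₂ : Codebook U₂ X₂ n,
    codebookProb P₁ Q₁ γ₁ c₁ * codebookProb P₂ Q₂ γ₂ c₂ * errorProb P₁ P₂ W c₁ c₂ (d c₁ c₂)

end codes

end MAC

end

/-!
Why the theorem holds.

**Source functions.** Let `Λ(s) = log ∑ᵤ P(u)^s`, so that `E_s(ρ) = (1 + ρ) Λ(1/(1+ρ))` and the
tilted mean is `Λ'`. The tangent line at `ρ_γ` is `(1 + ρ) A(log γ) + log γ`, where
`A(x) = inf_s (Λ(s) - s x)`: the infimum is attained at the solution `t` of the implicit equation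
and, at an end point of the range of `P`, approached as `s → ±∞`. For a threshold within the range
of `P`, therefore, `E_{s,1}` and `E_{s,2}` are `E_s` and this line, in an order that depends on the
sign of `log γ - Λ'(1/(1+ρ))` (`Esi_eq`).

**Attainment.** `A` is concave and nonnegative on the closed range of `log P`, hence continuous
there up to the end points. So `E_{s,i}` is jointly continuous in `(ρ, γ)` on the range of `P`, and
all thresholds below this range, as well as all thresholds above it, are equivalent
(`exists_compact_thresholds`). The maxima are then maxima of (semi)continuous functions on compact
sets.

**Chernoff bounds.** By convexity of `Λ`, `E_{s,i}` is also the infimum of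
`(1 + ρ) (Λ(s) - s log γ) + log γ` over `s` on one side of `1/(1+ρ)`, namely the side on which
`(Pⁿ(u) / γⁿ)^(s - 1/(1+ρ))` is at least the indicator of class `i`. Hence
`(∑ Pⁿ(u)^{1/(1+ρ)})^{1+ρ}` over class `i` is at most `exp (n e)` for all `e > E_{s,i}`
(`class_sum_le`).

**Random coding.** An error has a competitor that differs in the first, the second or both messages.
The classes `a` of a message and `b` of its competitor may have different optimal parameters `ρ_a`,
`ρ_b`. As `ρ_a ρ_b ≤ 1`, Gallager's argument may use the power `1/(1+ρ_a)` for the message and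
`1/(1+ρ_b)` for the competitor, with the outer exponent `r = ρ_a (1+ρ_b) / (1+ρ_a) ≤ 1`. After
averaging (Jensen's inequality and pairwise independence of codewords) the bound is
`∑_y A_a(y) A_b(y)^r`, and by Young's inequality
`A_a A_b^r ≤ A_a^{1+ρ_a} + A_b^{1+ρ_b}`: each class appears with its own optimal parameter
(`random_coding_bound`). These sums factor into source sums, bounded as above, and powers of the
channel sum in `E_0`. For errors in one message, the other message and its codeword are fixed first.

**Achievability.** Some pair of codebooks is at least as good as the average, and all MAP decoders
of a pair of codebooks have the same error probability.
-/

noncomputable section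

namespace MAC

/-! ### The partition function of a source and the affine branch of its exponents -/

section source

variable {U : Type*} [Fintype U] {P : U → ℝ}

theorem mem_supp {u : U} : u ∈ supp P ↔ P u ≠ 0 := by simp [supp]

theorem supp_pos (hP : P ∈ stdSimplex ℝ U) {u : U} (hu : u ∈ supp P) : 0 < P u :=
  lt_of_le_of_ne (hP.1 u) (Ne.symm (mem_supp.1 hu))

theorem supp_nonempty (hP : P ∈ stdSimplex ℝ U) : (supp P).Nonempty := by
  by_contra h
  have h0 : ∀ u, P u = 0 := fun u => by
    by_contra hu
    exact h ⟨u, mem_supp.2 hu⟩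
  simpa [h0] using hP.2

/-- The logarithm of the partition function `∑ᵤ P(u)^s` of the source; its derivative is
`tiltedMean P`. -/
def logPartition (P : U → ℝ) (s : ℝ) : ℝ := Real.log (∑ u ∈ supp P, P u ^ s)

theorem partition_pos (hP : P ∈ stdSimplex ℝ U) (s : ℝ) : 0 < ∑ u ∈ supp P, P u ^ s :=
  Finset.sum_pos (fun _ hu => Real.rpow_pos_of_pos (supp_pos hP hu) s) (supp_nonempty hP)

theorem Es_eq (hP : P ∈ stdSimplex ℝ U) (ρ : ℝ) :
    Es P ρ = (1 + ρ) * logPartition P (1 / (1 + ρ)) := by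
  rw [Es, Real.log_rpow (partition_pos hP _), logPartition]

theorem hasDerivAt_logPartition (hP : P ∈ stdSimplex ℝ U) (t : ℝ) :
    HasDerivAt (logPartition P) (tiltedMean P t) t := by
  refine HasDerivAt.log ?_ (partition_pos hP t).ne'
  refine HasDerivAt.fun_sum fun u hu => ?_
  exact ((hasDerivAt_id' t).const_rpow (supp_pos hP hu)).congr_deriv (by ring)

/-- The tangent to the convex function `logPartition P` at `t` lies below it (Gibbs' inequality). -/
theorem logPartition_tangent_le (hP : P ∈ stdSimplex ℝ U) (s t : ℝ) :
    logPartition P t + (s - t) * tiltedMean P t ≤ logPartition P s := by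
  have hZ := partition_pos hP t
  have key := convexOn_exp.map_sum_le (t := supp P)
    (w := fun u => P u ^ t / ∑ u ∈ supp P, P u ^ t) (p := fun u => (s - t) * Real.log (P u))
    (fun u hu => div_nonneg (Real.rpow_nonneg (supp_pos hP hu).le _) hZ.le)
    (by rw [← Finset.sum_div, div_self hZ.ne']) (fun _ _ => mem_univ _)
  have h1 : ∑ u ∈ supp P, (P u ^ t / ∑ u ∈ supp P, P u ^ t) • ((s - t) * Real.log (P u))
      = (s - t) * tiltedMean P t := by
    rw [tiltedMean, ← mul_div_assoc, Finset.mul_sum, Finset.sum_div]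
    refine Finset.sum_congr rfl fun u _ => ?_
    simp only [smul_eq_mul]; ring
  have h2 : ∑ u ∈ supp P, (P u ^ t / ∑ u ∈ supp P, P u ^ t) • Real.exp ((s - t) * Real.log (P u))
      = (∑ u ∈ supp P, P u ^ s) / ∑ u ∈ supp P, P u ^ t := by
    rw [Finset.sum_div]
    refine Finset.sum_congr rfl fun u hu => ?_
    have hu' := supp_pos hP hu
    rw [mul_comm (s - t), ← Real.rpow_def_of_pos hu', smul_eq_mul, div_mul_eq_mul_div,
      ← Real.rpow_add hu']
    congr 2; ring
  rw [h1, h2] at key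
  have h3 := (Real.le_log_iff_exp_le (div_pos (partition_pos hP s) hZ)).2 key
  rw [Real.log_div (partition_pos hP s).ne' hZ.ne'] at h3
  simp only [logPartition]; linarith

theorem tiltedMean_mono (hP : P ∈ stdSimplex ℝ U) : Monotone (tiltedMean P) := by
  intro s t hst
  rcases hst.eq_or_lt with rfl | h
  · exact le_rfl
  · have h1 := logPartition_tangent_le hP s t
    have h2 := logPartition_tangent_le hP t s
    nlinarith

theorem continuous_tiltedMean (hP : P ∈ stdSimplex ℝ U) : Continuous (tiltedMean P) := by
  unfold tiltedMean
  refine Continuous.div ?_ ?_ fun t => (partition_pos hP t).ne'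
  · refine continuous_finsetSum _ fun u hu => Continuous.mul ?_ continuous_const
    exact Real.continuous_const_rpow (supp_pos hP hu).ne'
  · exact continuous_finsetSum _ fun u hu => Real.continuous_const_rpow (supp_pos hP hu).ne'

/-- A bound on all letters is a bound on the tilted mean. -/
theorem le_tiltedMean (hP : P ∈ stdSimplex ℝ U) {γ : ℝ} (hγ : 0 < γ)
    (h : ∀ u ∈ supp P, γ ≤ P u) (t : ℝ) : Real.log γ ≤ tiltedMean P t := by
  rw [tiltedMean, le_div_iff₀ (partition_pos hP t), Finset.mul_sum]
  refine Finset.sum_le_sum fun u hu => ?_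
  rw [mul_comm]
  exact mul_le_mul_of_nonneg_left (Real.log_le_log hγ (h u hu))
    (Real.rpow_nonneg (supp_pos hP hu).le _)

theorem tiltedMean_le (hP : P ∈ stdSimplex ℝ U) {γ : ℝ}
    (h : ∀ u ∈ supp P, P u ≤ γ) (t : ℝ) : tiltedMean P t ≤ Real.log γ := by
  rw [tiltedMean, div_le_iff₀ (partition_pos hP t), Finset.mul_sum]
  refine Finset.sum_le_sum fun u hu => ?_
  rw [mul_comm (Real.log γ)]
  exact mul_le_mul_of_nonneg_left (Real.log_le_log (supp_pos hP hu) (h u hu))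
    (Real.rpow_nonneg (supp_pos hP hu).le _)

theorem logPartition_ge (hP : P ∈ stdSimplex ℝ U) {u : U} (hu : u ∈ supp P) (s : ℝ) :
    s * Real.log (P u) ≤ logPartition P s := by
  have hu' := supp_pos hP hu
  rw [← Real.log_rpow hu']
  exact Real.log_le_log (Real.rpow_pos_of_pos hu' s)
    (Finset.single_le_sum (f := fun u => P u ^ s)
      (fun v hv => Real.rpow_nonneg (supp_pos hP hv).le _) hu)

/-- The implicit equation of `ρ_γ` is solvable for a threshold strictly inside the range of `P`:
its solution is the minimizer of the coercive function `s ↦ log ∑ᵤ P(u)^s - s log γ`. -/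
theorem exists_tiltedMean_eq (hP : P ∈ stdSimplex ℝ U) {γ : ℝ} (hγ : 0 < γ)
    {u v : U} (hu : u ∈ supp P) (hv : v ∈ supp P) (huγ : P u < γ) (hvγ : γ < P v) :
    ∃ t, tiltedMean P t = Real.log γ := by
  have hd : ∀ s, HasDerivAt (fun s => logPartition P s - s * Real.log γ)
      (tiltedMean P s - Real.log γ) s := fun s =>
    ((hasDerivAt_logPartition hP s).fun_sub ((hasDerivAt_id' s).mul_const (Real.log γ))).congr_deriv
      (by ring)
  have hcont : Continuous (fun s => logPartition P s - s * Real.log γ) :=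
    continuous_iff_continuousAt.2 fun s => (hd s).continuousAt
  have hlim : Tendsto (fun s => logPartition P s - s * Real.log γ) (cocompact ℝ) atTop := by
    rw [cocompact_eq_atBot_atTop, tendsto_sup]
    have h1 : Real.log (P u) - Real.log γ < 0 :=
      sub_neg.2 (Real.log_lt_log (supp_pos hP hu) huγ)
    have h2 : 0 < Real.log (P v) - Real.log γ := sub_pos.2 (Real.log_lt_log hγ hvγ)
    constructor
    · refine tendsto_atTop_mono (fun s => ?_) (tendsto_id.atBot_mul_const_of_neg h1)
      have := logPartition_ge hP hu s
      simp only [id]; linarith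
    · refine tendsto_atTop_mono (fun s => ?_) (tendsto_id.atTop_mul_const h2)
      have := logPartition_ge hP hv s
      simp only [id]; linarith
  obtain ⟨t, ht⟩ := hcont.exists_forall_le hlim
  refine ⟨t, sub_eq_zero.1 ?_⟩
  exact IsLocalMin.hasDerivAt_eq_zero (Filter.Eventually.of_forall ht) (hd t)

theorem deriv_Es (hP : P ∈ stdSimplex ℝ U) {r : ℝ} (hr : 1 + r ≠ 0) :
    deriv (Es P) r = logPartition P (1 / (1 + r)) - 1 / (1 + r) * tiltedMean P (1 / (1 + r)) := by
  have h1 : HasDerivAt (fun r : ℝ => 1 / (1 + r)) (-1 / (1 + r) ^ 2) r := by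
    simp_rw [one_div]
    exact ((hasDerivAt_id' r).const_add 1).fun_inv hr
  have h2 := (hasDerivAt_logPartition hP (1 / (1 + r))).comp r h1
  have h3 := ((hasDerivAt_id r).const_add 1).mul h2
  have h4 : Es P = fun r => (1 + r) * logPartition P (1 / (1 + r)) := funext (Es_eq hP)
  rw [h4]
  refine (h3.congr_deriv ?_).deriv
  simp only [Function.comp, id]
  field_simp
  ring

/-- In terms of `t = 1 / (1 + ρ_γ)` the tangent line is `(1 + ρ) (log ∑ᵤ P(u)^t - t μ) + μ`, with
`μ` the tilted mean at `t`. -/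
theorem tangentLine_eq (hP : P ∈ stdSimplex ℝ U) (t ρ : ℝ) :
    tangentLine P t ρ = (1 + ρ) * (logPartition P t - t * tiltedMean P t) + tiltedMean P t := by
  by_cases ht : t = 0
  · subst ht
    simp [tangentLine, logPartition, tiltedMean]
  · have h1 : 1 / (1 + (1 / t - 1)) = t := by field_simp; ring
    have h2 : 1 + (1 / t - 1) ≠ 0 := by
      have : 1 / t ≠ 0 := one_div_ne_zero ht
      simpa using this
    rw [tangentLine, if_neg ht, Es_eq hP, deriv_Es hP h2, h1]
    field_simp
    ring

theorem logPartition_sub_eq (hP : P ∈ stdSimplex ℝ U) {γ : ℝ} (hγ : 0 < γ) (s : ℝ) :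
    logPartition P s - s * Real.log γ = Real.log (∑ u ∈ supp P, (P u / γ) ^ s) := by
  have h : ∑ u ∈ supp P, (P u / γ) ^ s = (∑ u ∈ supp P, P u ^ s) / γ ^ s := by
    rw [Finset.sum_div]
    exact Finset.sum_congr rfl fun u hu => Real.div_rpow (supp_pos hP hu).le hγ.le s
  rw [h, Real.log_div (partition_pos hP s).ne' (Real.rpow_pos_of_pos hγ s).ne',
    Real.log_rpow hγ, logPartition]

open Classical in
/-- `log #{u | P(u) = γ}` is the infimum of `s ↦ log ∑ᵤ P(u)^s - s log γ` at an end point `γ` of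
the range of `P`, where the infimum is approached as `s → +∞` or `s → -∞`. -/
theorem isGLB_endpoint (hP : P ∈ stdSimplex ℝ U) {γ : ℝ} (hγ : 0 < γ) {v : U} (hv : P v = γ)
    (h : (∀ u ∈ supp P, P u ≤ γ) ∨ ∀ u ∈ supp P, γ ≤ P u) :
    IsGLB (Set.range fun s => logPartition P s - s * Real.log γ)
      (Real.log ((Finset.univ.filter (fun u => P u = γ)).card : ℝ)) := by
  have hcard : ((Finset.univ.filter (fun u => P u = γ)).card : ℝ)
      = ∑ u ∈ supp P, if P u = γ then (1 : ℝ) else 0 := by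
    rw [Finset.card_filter, Nat.cast_sum, supp, Finset.sum_filter]
    refine Finset.sum_congr rfl fun u _ => ?_
    by_cases h1 : P u = γ
    · simp [h1, hγ.ne']
    · simp [h1]
  have hpos : (0 : ℝ) < ((Finset.univ.filter (fun u => P u = γ)).card : ℝ) := by
    exact_mod_cast Finset.card_pos.2 ⟨v, by simp [hv]⟩
  have hlb : ∀ s, Real.log ((Finset.univ.filter (fun u => P u = γ)).card : ℝ)
      ≤ logPartition P s - s * Real.log γ := fun s => by
    rw [logPartition_sub_eq hP hγ]
    refine Real.log_le_log hpos ?_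
    rw [hcard]
    refine Finset.sum_le_sum fun u hu => ?_
    by_cases h1 : P u = γ
    · simp [h1, div_self hγ.ne']
    · simpa [h1] using Real.rpow_nonneg (div_nonneg (supp_pos hP hu).le hγ.le) s
  have hlim : ∃ l : Filter ℝ, l.NeBot ∧ Tendsto (fun s => logPartition P s - s * Real.log γ) l
      (nhds (Real.log ((Finset.univ.filter (fun u => P u = γ)).card : ℝ))) := by
    have aux : ∀ l : Filter ℝ, (∀ u ∈ supp P, P u ≠ γ →
        Tendsto (fun s => (P u / γ) ^ s) l (nhds 0)) →
        Tendsto (fun s => logPartition P s - s * Real.log γ) l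
          (nhds (Real.log ((Finset.univ.filter (fun u => P u = γ)).card : ℝ))) := by
      intro l hl
      simp_rw [logPartition_sub_eq hP hγ]
      refine Tendsto.log ?_ hpos.ne'
      rw [hcard]
      refine tendsto_finsetSum _ fun u hu => ?_
      by_cases h1 : P u = γ
      · have h2 : (fun s : ℝ => (P u / γ) ^ s) = fun _ => (1 : ℝ) := by
          ext s
          rw [h1, div_self hγ.ne', Real.one_rpow]
        rw [if_pos h1]
        change Tendsto (fun s : ℝ => (P u / γ) ^ s) l _
        rw [h2]
        exact tendsto_const_nhds
      · simpa [h1] using hl u hu h1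
    rcases h with h | h
    · refine ⟨atTop, inferInstance, aux _ fun u hu hne => ?_⟩
      have h0 : 0 < P u / γ := div_pos (supp_pos hP hu) hγ
      exact tendsto_rpow_atTop_of_base_lt_one _ (by linarith)
        ((div_lt_one hγ).2 (lt_of_le_of_ne (h u hu) hne))
    · refine ⟨atBot, inferInstance, aux _ fun u hu hne => ?_⟩
      exact tendsto_rpow_atBot_of_base_gt_one _
        ((one_lt_div hγ).2 (lt_of_le_of_ne (h u hu) (Ne.symm hne)))
  obtain ⟨l, hl, hl'⟩ := hlim
  refine ⟨?_, fun b hb => ?_⟩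
  · rintro _ ⟨s, rfl⟩
    exact hlb s
  · exact ge_of_tendsto' hl' fun s => hb ⟨s, rfl⟩

/-- The Legendre transform `inf_s (log ∑ᵤ P(u)^s - s x)` of `logPartition P`. For `x = log γ` it is
the exponential growth rate of the number of messages with probability about `γ^n`. -/
def growthRate (P : U → ℝ) (x : ℝ) : ℝ := ⨅ s : ℝ, (logPartition P s - s * x)

theorem logPartition_sub_nonneg (hP : P ∈ stdSimplex ℝ U) {x : ℝ} {u v : U} (hu : u ∈ supp P)
    (hv : v ∈ supp P) (hux : Real.log (P u) ≤ x) (hvx : x ≤ Real.log (P v)) (s : ℝ) :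
    0 ≤ logPartition P s - s * x := by
  rcases le_total 0 s with hs | hs
  · nlinarith [logPartition_ge hP hv s]
  · nlinarith [logPartition_ge hP hu s]

theorem growthRate_le (hP : P ∈ stdSimplex ℝ U) {x : ℝ} {u v : U} (hu : u ∈ supp P)
    (hv : v ∈ supp P) (hux : Real.log (P u) ≤ x) (hvx : x ≤ Real.log (P v)) (s : ℝ) :
    growthRate P x ≤ logPartition P s - s * x :=
  ciInf_le ⟨0, by rintro _ ⟨s, rfl⟩; exact logPartition_sub_nonneg hP hu hv hux hvx s⟩ s

theorem growthRate_of_tiltedMean_eq (hP : P ∈ stdSimplex ℝ U) {x t : ℝ}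
    (ht : tiltedMean P t = x) : growthRate P x = logPartition P t - t * x := by
  refine IsGLB.ciInf_eq (IsLeast.isGLB ⟨⟨t, rfl⟩, ?_⟩)
  rintro _ ⟨s, rfl⟩
  have := logPartition_tangent_le hP s t
  rw [ht] at this
  simp only; linarith

/-- The affine branch of `E_{s,1}` and `E_{s,2}`. -/
def rateLine (P : U → ℝ) (ρ γ : ℝ) : ℝ := (1 + ρ) * growthRate P (Real.log γ) + Real.log γ

theorem tangentLine_eq_rateLine (hP : P ∈ stdSimplex ℝ U) {γ t : ℝ}
    (ht : tiltedMean P t = Real.log γ) (ρ : ℝ) : tangentLine P t ρ = rateLine P ρ γ := by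
  rw [tangentLine_eq hP, rateLine, growthRate_of_tiltedMean_eq hP ht, ht]

theorem endLine_eq_rateLine (hP : P ∈ stdSimplex ℝ U) {γ : ℝ} (hγ : 0 < γ) {v : U} (hv : P v = γ)
    (h : (∀ u ∈ supp P, P u ≤ γ) ∨ ∀ u ∈ supp P, γ ≤ P u) (ρ : ℝ) :
    endLine P γ ρ = rateLine P ρ γ := by
  rw [endLine, rateLine, growthRate, (isGLB_endpoint hP hγ hv h).ciInf_eq]

/-- The affine branch meets `E_s` at `ρ = ρ_γ`. -/
theorem rateLine_eq_Es (hP : P ∈ stdSimplex ℝ U) {γ ρ : ℝ} (hρ : 1 + ρ ≠ 0)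
    (h : tiltedMean P (1 / (1 + ρ)) = Real.log γ) : rateLine P ρ γ = Es P ρ := by
  rw [rateLine, growthRate_of_tiltedMean_eq hP h, Es_eq hP]
  field_simp
  ring

/-- For a threshold within the range of `P`, `E_{s,1}` and `E_{s,2}` are `E_s` and the affine
branch, in the order determined by comparing `log γ` with the tilted mean at `1 / (1 + ρ)`. -/
theorem Esi_eq (hP : P ∈ stdSimplex ℝ U) {γ ρ : ℝ} (hρ : 1 + ρ ≠ 0) {u v : U} (hu : u ∈ supp P)
    (hv : v ∈ supp P) (huγ : P u ≤ γ) (hvγ : γ ≤ P v) :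
    (Real.log γ ≤ tiltedMean P (1 / (1 + ρ)) →
      Es1 ρ P γ = (Es P ρ : ℝ) ∧ Es2 ρ P γ = (rateLine P ρ γ : ℝ)) ∧
    (tiltedMean P (1 / (1 + ρ)) ≤ Real.log γ →
      Es1 ρ P γ = (rateLine P ρ γ : ℝ) ∧ Es2 ρ P γ = (Es P ρ : ℝ)) := by
  have hγ : 0 < γ := (supp_pos hP hu).trans_le huγ
  have n1 : ¬ ∀ u, P u ≠ 0 → γ < P u := fun h => (h u (mem_supp.1 hu)).not_ge huγ
  have n2 : ¬ ∀ u, P u < γ := fun h => (h v).not_ge hvγ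
  unfold Es1 Es2
  rw [if_neg n1, if_neg n2, if_neg n1, if_neg n2]
  by_cases hex : ∃ t : ℝ, tiltedMean P t = Real.log γ
  · rw [dif_pos hex, dif_pos hex]
    have ht := hex.choose_spec
    set t := hex.choose
    rw [tangentLine_eq_rateLine hP ht]
    rcases le_or_gt t (1 / (1 + ρ)) with hle | hlt
    · rw [if_pos hle, if_neg hle.not_gt]
      refine ⟨fun _ => ⟨rfl, rfl⟩, fun h => ?_⟩
      have := rateLine_eq_Es hP hρ (le_antisymm h (ht ▸ tiltedMean_mono hP hle))
      rw [this]
      exact ⟨rfl, rfl⟩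
    · rw [if_neg hlt.not_ge, if_pos hlt]
      refine ⟨fun h => ?_, fun _ => ⟨rfl, rfl⟩⟩
      have := rateLine_eq_Es hP hρ (le_antisymm (ht ▸ tiltedMean_mono hP hlt.le) h)
      rw [this]
      exact ⟨rfl, rfl⟩
  · rw [dif_neg hex, dif_neg hex]
    have hne : tiltedMean P (1 / (1 + ρ)) ≠ Real.log γ := fun h => hex ⟨_, h⟩
    by_cases hmin : ∀ u, P u ≠ 0 → γ ≤ P u
    · rw [if_pos hmin, if_pos hmin]
      have hmin' : ∀ u ∈ supp P, γ ≤ P u := fun u hu => hmin u (mem_supp.1 hu)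
      rw [endLine_eq_rateLine hP hγ (le_antisymm huγ (hmin' u hu)) (Or.inr hmin')]
      exact ⟨fun _ => ⟨rfl, rfl⟩, fun h => (hne (h.antisymm (le_tiltedMean hP hγ hmin' _))).elim⟩
    · rw [if_neg hmin, if_neg hmin]
      push Not at hmin
      obtain ⟨w, hw, hwγ⟩ := hmin
      have hmax : ∀ u ∈ supp P, P u ≤ γ := fun u hu => by
        by_contra hlt
        exact hex (exists_tiltedMean_eq hP hγ (mem_supp.2 hw) hu hwγ (not_le.1 hlt))
      rw [endLine_eq_rateLine hP hγ (le_antisymm (hmax v hv) hvγ) (Or.inl hmax)]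
      exact ⟨fun h => (hne ((tiltedMean_le hP hmax _).antisymm h)).elim, fun _ => ⟨rfl, rfl⟩⟩

end source

/-! ### Chernoff bounds for the message classes -/

section classes

variable {U : Type*} [Fintype U] {P : U → ℝ}

theorem exists_min_letter (hP : P ∈ stdSimplex ℝ U) : ∃ a ∈ supp P, ∀ u ∈ supp P, P a ≤ P u :=
  Finset.exists_min_image _ _ (supp_nonempty hP)

theorem exists_max_letter (hP : P ∈ stdSimplex ℝ U) : ∃ b ∈ supp P, ∀ u, P u ≤ P b := by
  obtain ⟨b, hb, h⟩ := Finset.exists_max_image (supp P) P (supp_nonempty hP)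
  refine ⟨b, hb, fun u => ?_⟩
  by_cases hu : u ∈ supp P
  · exact h u hu
  · rw [mem_supp, not_not] at hu
    exact hu ▸ (supp_pos hP hb).le

theorem Esi_of_lt_min {γ : ℝ} (h : ∀ u ∈ supp P, γ < P u) (i : Fin 2) (ρ : ℝ) :
    Esi i ρ P γ = if i = 0 then ((Es P ρ : ℝ) : EReal) else ⊥ := by
  have h' : ∀ u, P u ≠ 0 → γ < P u := fun u hu => h u (mem_supp.2 hu)
  unfold Esi Es1 Es2
  rw [if_pos h', if_pos h']

theorem Esi_of_max_lt (hP : P ∈ stdSimplex ℝ U) {γ : ℝ} (h : ∀ u, P u < γ) (i : Fin 2) (ρ : ℝ) :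
    Esi i ρ P γ = if i = 0 then ⊥ else ((Es P ρ : ℝ) : EReal) := by
  obtain ⟨u, hu⟩ := supp_nonempty hP
  have h' : ¬ ∀ u, P u ≠ 0 → γ < P u := fun h' => (h' u (mem_supp.1 hu)).not_gt (h u)
  unfold Esi Es1 Es2
  rw [if_neg h', if_pos h, if_neg h', if_pos h]

/-- `E_{s,1}` and `E_{s,2}` are infima, over `s ≥ 1/(1+ρ)` and over `s ≤ 1/(1+ρ)`, of
`s ↦ (1 + ρ) (log ∑ᵤ P(u)^s - s log γ) + log γ`. -/
theorem exists_exponent_lt (hP : P ∈ stdSimplex ℝ U) {ρ γ e : ℝ} (hρ : 0 ≤ ρ) {u v : U}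
    (hu : u ∈ supp P) (hv : v ∈ supp P) (huγ : P u ≤ γ) (hvγ : γ ≤ P v) {i : Fin 2}
    (he : Esi i ρ P γ < (e : EReal)) :
    ∃ s, (if i = 0 then 1 / (1 + ρ) ≤ s else s ≤ 1 / (1 + ρ)) ∧
      (1 + ρ) * (logPartition P s - s * Real.log γ) + Real.log γ < e := by
  have h1 : (0 : ℝ) < 1 + ρ := by linarith
  obtain ⟨hA, hB⟩ := Esi_eq hP h1.ne' hu hv huγ hvγ
  have hEs : Es P ρ < e → ∃ s, (if i = 0 then 1 / (1 + ρ) ≤ s else s ≤ 1 / (1 + ρ)) ∧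
      (1 + ρ) * (logPartition P s - s * Real.log γ) + Real.log γ < e := fun h => by
    refine ⟨1 / (1 + ρ), by split_ifs <;> exact le_rfl, ?_⟩
    rw [Es_eq hP] at h
    have : (1 + ρ) * (1 / (1 + ρ) * Real.log γ) = Real.log γ := by field_simp
    rw [mul_sub, this]; linarith
  -- A minimizer on the wrong side of `1/(1+ρ)` may be replaced by `1/(1+ρ)`, by convexity.
  have hline : (if i = 0 then tiltedMean P (1 / (1 + ρ)) ≤ Real.log γ
      else Real.log γ ≤ tiltedMean P (1 / (1 + ρ))) → rateLine P ρ γ < e →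
      ∃ s, (if i = 0 then 1 / (1 + ρ) ≤ s else s ≤ 1 / (1 + ρ)) ∧
      (1 + ρ) * (logPartition P s - s * Real.log γ) + Real.log γ < e := fun hm h => by
    have h2 : growthRate P (Real.log γ) < (e - Real.log γ) / (1 + ρ) := by
      rw [lt_div_iff₀ h1]
      rw [rateLine] at h; linarith
    obtain ⟨s, hs⟩ := exists_lt_of_ciInf_lt h2
    have hfin : ∀ s, logPartition P s - s * Real.log γ < (e - Real.log γ) / (1 + ρ) →
        (1 + ρ) * (logPartition P s - s * Real.log γ) + Real.log γ < e := fun s hs => by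
      rw [lt_div_iff₀ h1] at hs; linarith
    by_cases hside : if i = 0 then 1 / (1 + ρ) ≤ s else s ≤ 1 / (1 + ρ)
    · exact ⟨s, hside, hfin s hs⟩
    · refine ⟨1 / (1 + ρ), by split_ifs <;> exact le_rfl, hfin _ (lt_of_le_of_lt ?_ hs)⟩
      have ht := logPartition_tangent_le hP s (1 / (1 + ρ))
      by_cases hi : i = 0
      · simp only [hi, if_true, not_le] at hside hm
        nlinarith
      · simp only [hi, if_false, not_le] at hside hm
        nlinarith
  rcases le_total (Real.log γ) (tiltedMean P (1 / (1 + ρ))) with hle | hle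
  · obtain ⟨e1, e2⟩ := hA hle
    by_cases hi : i = 0
    · rw [Esi, if_pos hi, e1] at he
      exact hEs (by exact_mod_cast he)
    · rw [Esi, if_neg hi, e2] at he
      exact hline (by rwa [if_neg hi]) (by exact_mod_cast he)
  · obtain ⟨e1, e2⟩ := hB hle
    by_cases hi : i = 0
    · rw [Esi, if_pos hi, e1] at he
      exact hline (by rwa [if_pos hi]) (by exact_mod_cast he)
    · rw [Esi, if_neg hi, e2] at he
      exact hEs (by exact_mod_cast he)

theorem seqProb_nonneg {A : Type*} {P : A → ℝ} (hP : ∀ a, 0 ≤ P a) {n : ℕ} (a : Fin n → A) :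
    0 ≤ seqProb P a := Finset.prod_nonneg fun _ _ => hP _

theorem sum_prod_seq {A : Type*} [Fintype A] (f : A → ℝ) (n : ℕ) :
    ∑ a : Fin n → A, ∏ l, f (a l) = (∑ a, f a) ^ n := by
  classical
  have := Finset.prod_univ_sum (fun _ : Fin n => (Finset.univ : Finset A)) (fun _ a => f a)
  simpa using this.symm

theorem seqProb_rpow {A : Type*} {P : A → ℝ} (hP : ∀ a, 0 ≤ P a) {n : ℕ} (a : Fin n → A)
    (s : ℝ) :
    seqProb P a ^ s = ∏ l, P (a l) ^ s :=
  (Real.finsetProd_rpow _ _ (fun _ _ => hP _) s).symm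

theorem sum_seqProb_rpow_le (hP : P ∈ stdSimplex ℝ U) (n : ℕ) (s : ℝ) (T : Finset (Fin n → U))
    (hT : ∀ a ∈ T, seqProb P a ≠ 0) :
    ∑ a ∈ T, seqProb P a ^ s ≤ (∑ u ∈ supp P, P u ^ s) ^ n := by
  classical
  have h1 : (∑ u ∈ supp P, P u ^ s) ^ n
      = ∑ a ∈ Fintype.piFinset (fun _ : Fin n => supp P), ∏ l, P (a l) ^ s := by
    have := Finset.prod_univ_sum (fun _ : Fin n => supp P) (fun _ a => P a ^ s)
    simpa using this
  rw [h1]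
  simp_rw [seqProb_rpow hP.1]
  refine Finset.sum_le_sum_of_subset_of_nonneg (fun a ha => ?_) fun a _ _ =>
    Finset.prod_nonneg fun l _ => Real.rpow_nonneg (hP.1 _) _
  rw [Fintype.mem_piFinset]
  exact fun l => mem_supp.2 fun h0 => hT a ha (Finset.prod_eq_zero (Finset.mem_univ l) h0)

/-- Chernoff bound: `(∑ Pⁿ(u)^{1/(1+ρ)})^{1+ρ}` over the messages `u` of class `i` is at most
`exp (n e)` for every `e > E_{s,i}(ρ, P, γ)`. -/
theorem class_sum_le (hP : P ∈ stdSimplex ℝ U) {ρ γ e : ℝ} (hρ : 0 ≤ ρ) (hγ : 0 ≤ γ) {i : Fin 2}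
    (he : Esi i ρ P γ < (e : EReal)) (n : ℕ) :
    (∑ u : Fin n → U with msgClass P γ u = i, seqProb P u ^ (1 / (1 + ρ))) ^ (1 + ρ)
      ≤ Real.exp (n * e) := by
  classical
  have h1 : (0 : ℝ) < 1 + ρ := by linarith
  have h2 : 1 / (1 + ρ) ≠ 0 := (one_div_pos.2 h1).ne'
  set T : Finset (Fin n → U) :=
    Finset.univ.filter fun u => msgClass P γ u = i ∧ seqProb P u ≠ 0 with hTdef
  have hsum : ∑ u : Fin n → U with msgClass P γ u = i, seqProb P u ^ (1 / (1 + ρ))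
      = ∑ u ∈ T, seqProb P u ^ (1 / (1 + ρ)) := by
    refine (Finset.sum_subset (fun u hu => ?_) fun u hu hu' => ?_).symm
    · simp only [hTdef, Finset.mem_filter] at hu ⊢
      exact ⟨hu.1, hu.2.1⟩
    · have h0 : seqProb P u = 0 := by
        by_contra h0
        exact hu' (Finset.mem_filter.2 ⟨Finset.mem_univ _, (Finset.mem_filter.1 hu).2, h0⟩)
      rw [h0, Real.zero_rpow h2]
  have hletter : ∀ u ∈ T, ∀ l, u l ∈ supp P := fun u hu l => mem_supp.2 fun h0 =>
    (Finset.mem_filter.1 hu).2.2 (Finset.prod_eq_zero (Finset.mem_univ l) h0)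
  have hempty : T = ∅ → (∑ u ∈ T, seqProb P u ^ (1 / (1 + ρ))) ^ (1 + ρ) ≤ Real.exp (n * e) :=
    fun h => by simp [h, Real.zero_rpow h1.ne', Real.exp_nonneg]
  have hchernoff : 0 < γ → ∀ s, (if i = 0 then 1 / (1 + ρ) ≤ s else s ≤ 1 / (1 + ρ)) →
      (1 + ρ) * (logPartition P s - s * Real.log γ) + Real.log γ < e →
      (∑ u ∈ T, seqProb P u ^ (1 / (1 + ρ))) ^ (1 + ρ) ≤ Real.exp (n * e) := by
    intro hγ s hs hse
    have hterm : ∀ u ∈ T, seqProb P u ^ (1 / (1 + ρ))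
        ≤ seqProb P u ^ s * (γ ^ n) ^ (1 / (1 + ρ) - s) := fun u hu => by
      obtain ⟨-, hcl, h0⟩ := Finset.mem_filter.1 hu
      have hpos : 0 < seqProb P u := lt_of_le_of_ne (seqProb_nonneg hP.1 u) (Ne.symm h0)
      have : seqProb P u ^ (1 / (1 + ρ))
          = seqProb P u ^ s * seqProb P u ^ (1 / (1 + ρ) - s) := by
        rw [← Real.rpow_add hpos]; congr 1; ring
      rw [this]
      refine mul_le_mul_of_nonneg_left ?_ (Real.rpow_nonneg hpos.le _)
      by_cases hi : i = 0
      · simp only [hi, if_true] at hs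
        have : γ ^ n ≤ seqProb P u := by
          by_contra hlt
          simp [msgClass, hlt, hi] at hcl
        exact Real.rpow_le_rpow_of_nonpos (pow_pos hγ n) this (by linarith)
      · simp only [hi, if_false] at hs
        have : seqProb P u ≤ γ ^ n := by
          by_contra hlt
          simp [msgClass, (not_le.1 hlt).le] at hcl
          exact hi hcl.symm
        exact Real.rpow_le_rpow hpos.le this (by linarith)
    have hS : ∑ u ∈ T, seqProb P u ^ (1 / (1 + ρ))
        ≤ Real.exp (n * (logPartition P s + (1 / (1 + ρ) - s) * Real.log γ)) := by
      refine (Finset.sum_le_sum hterm).trans ?_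
      rw [← Finset.sum_mul]
      have e1 : Real.exp (n * (logPartition P s + (1 / (1 + ρ) - s) * Real.log γ))
          = (∑ u ∈ supp P, P u ^ s) ^ n * (γ ^ n) ^ (1 / (1 + ρ) - s) := by
        rw [mul_add, Real.exp_add, logPartition, Real.exp_nat_mul,
          Real.exp_log (partition_pos hP s), Real.rpow_def_of_pos (pow_pos hγ n), Real.log_pow]
        congr 2; ring
      rw [e1]
      exact mul_le_mul_of_nonneg_right
        (sum_seqProb_rpow_le hP n s T fun u hu => (Finset.mem_filter.1 hu).2.2)
        (Real.rpow_nonneg (pow_pos hγ n).le _)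
    refine (Real.rpow_le_rpow (Finset.sum_nonneg fun u _ =>
      Real.rpow_nonneg (seqProb_nonneg hP.1 u) _) hS h1.le).trans ?_
    rw [← Real.exp_mul]
    refine Real.exp_le_exp.2 ?_
    have : (n : ℝ) * (logPartition P s + (1 / (1 + ρ) - s) * Real.log γ) * (1 + ρ)
        = n * ((1 + ρ) * (logPartition P s - s * Real.log γ) + Real.log γ) := by
      field_simp; ring
    rw [this]
    exact mul_le_mul_of_nonneg_left hse.le (Nat.cast_nonneg n)
  rw [hsum]
  obtain ⟨a, ha, hamin⟩ := exists_min_letter hP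
  obtain ⟨b, hb, hbmax⟩ := exists_max_letter hP
  rcases lt_or_ge γ (P a) with hlt | hge
  · have hlt' : ∀ u ∈ supp P, γ < P u := fun u hu => hlt.trans_le (hamin u hu)
    rw [Esi_of_lt_min hlt'] at he
    by_cases hi : i = 0
    · rw [if_pos hi, Es_eq hP] at he
      have he' : (1 + ρ) * logPartition P (1 / (1 + ρ)) < e := by exact_mod_cast he
      refine (Real.rpow_le_rpow (Finset.sum_nonneg fun u _ =>
        Real.rpow_nonneg (seqProb_nonneg hP.1 u) _) (sum_seqProb_rpow_le hP n _ T
          fun u hu => (Finset.mem_filter.1 hu).2.2) h1.le).trans ?_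
      rw [← Real.exp_log (partition_pos hP (1 / (1 + ρ))), ← Real.exp_nat_mul, ← Real.exp_mul]
      refine Real.exp_le_exp.2 ?_
      rw [mul_assoc]
      refine mul_le_mul_of_nonneg_left ?_ (Nat.cast_nonneg n)
      rw [mul_comm]; exact he'.le
    · refine hempty (Finset.eq_empty_of_forall_notMem fun u hu => ?_)
      have : γ ^ n ≤ seqProb P u := by
        have := Finset.prod_le_prod (s := Finset.univ) (f := fun _ : Fin n => γ)
          (g := fun l => P (u l)) (fun _ _ => hγ) (fun l _ => (hlt' _ (hletter u hu l)).le)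
        simpa [seqProb] using this
      have hcl := (Finset.mem_filter.1 hu).2.1
      simp [msgClass, this] at hcl
      exact hi hcl.symm
  · have hγ' : 0 < γ := (supp_pos hP ha).trans_le hge
    rcases le_or_gt γ (P b) with hle | hgt
    · obtain ⟨s, hs, hs'⟩ := exists_exponent_lt hP hρ ha hb hge hle he
      exact hchernoff hγ' s hs hs'
    · have hgt' : ∀ u, P u < γ := fun u => (hbmax u).trans_lt hgt
      rw [Esi_of_max_lt hP hgt'] at he
      by_cases hi : i = 0
      · rcases Nat.eq_zero_or_pos n with rfl | hn
        · have : ∑ u ∈ T, seqProb P u ^ (1 / (1 + ρ)) ≤ 1 := by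
            simpa using sum_seqProb_rpow_le hP 0 (1 / (1 + ρ)) T
              fun u hu => (Finset.mem_filter.1 hu).2.2
          simpa using Real.rpow_le_one (Finset.sum_nonneg fun u _ =>
            Real.rpow_nonneg (seqProb_nonneg hP.1 u) _) this h1.le
        · refine hempty (Finset.eq_empty_of_forall_notMem fun u hu => ?_)
          have : seqProb P u < γ ^ n := by
            have := Finset.prod_lt_prod_of_nonempty (s := Finset.univ)
              (f := fun l => P (u l)) (g := fun _ : Fin n => γ)
              (fun l _ => supp_pos hP (hletter u hu l)) (fun l _ => hgt' _)
              ⟨⟨0, hn⟩, Finset.mem_univ _⟩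
            simpa [seqProb] using this
          have hcl := (Finset.mem_filter.1 hu).2.1
          simp [msgClass, this.not_ge, hi] at hcl
      · rw [if_neg hi, Es_eq hP] at he
        have he' : (1 + ρ) * logPartition P (1 / (1 + ρ)) < e := by exact_mod_cast he
        refine hchernoff hγ' (1 / (1 + ρ)) (by rw [if_neg hi]) ?_
        have : (1 + ρ) * (1 / (1 + ρ) * Real.log γ) = Real.log γ := by field_simp
        rw [mul_sub, this]; linarith

end classes

/-! ### Continuity of the source and channel functions -/

section sourceContinuity

variable {U : Type*} [Fintype U] {P : U → ℝ}

theorem continuous_logPartition (hP : P ∈ stdSimplex ℝ U) : Continuous (logPartition P) :=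
  continuous_iff_continuousAt.2 fun s => (hasDerivAt_logPartition hP s).continuousAt

/-- Continuity of the growth rate on the closed range of `log P`. It is upper semicontinuous as an
infimum of continuous functions; it is lower semicontinuous, also at the end points, since it is
concave and nonnegative. -/
theorem continuousOn_growthRate (hP : P ∈ stdSimplex ℝ U) {a b : U} (ha : a ∈ supp P)
    (hb : b ∈ supp P) :
    ContinuousOn (growthRate P) (Icc (Real.log (P a)) (Real.log (P b))) := by
  set α := Real.log (P a)
  set β := Real.log (P b)
  intro x₀ hx₀
  have hnn : ∀ x ∈ Icc α β, ∀ s, 0 ≤ logPartition P s - s * x := fun x hx s =>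
    logPartition_sub_nonneg hP ha hb hx.1 hx.2 s
  have hle : ∀ x ∈ Icc α β, ∀ s, growthRate P x ≤ logPartition P s - s * x := fun x hx s =>
    growthRate_le hP ha hb hx.1 hx.2 s
  -- Concavity along the segment from `x₀` to an end point `z`.
  have hconc : ∀ z ∈ Icc α β, ∀ x, 0 ≤ (z - x) / (z - x₀) → 0 ≤ (x - x₀) / (z - x₀) → z - x₀ ≠ 0 →
      growthRate P x₀ * ((z - x) / (z - x₀)) ≤ growthRate P x := by
    intro z hz x h1 h2 h3
    refine le_ciInf fun s => ?_
    have e : logPartition P s - s * x = (z - x) / (z - x₀) * (logPartition P s - s * x₀)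
        + (x - x₀) / (z - x₀) * (logPartition P s - s * z) := by
      field_simp; ring
    rw [e]
    have := mul_le_mul_of_nonneg_left (hle x₀ hx₀ s) h1
    have := mul_nonneg h2 (hnn z hz s)
    linarith
  have hev : ∀ z, z - x₀ ≠ 0 → ∀ c < growthRate P x₀,
      ∀ᶠ x in nhdsWithin x₀ (Icc α β), c < growthRate P x₀ * ((z - x) / (z - x₀)) := by
    intro z hz c hc
    have hcont : ContinuousAt (fun x => growthRate P x₀ * ((z - x) / (z - x₀))) x₀ := by
      fun_prop
    refine nhdsWithin_le_nhds (hcont.eventually_const_lt ?_)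
    simpa only [div_self hz, mul_one] using hc
  refine tendsto_order.2 ⟨fun c hc => ?_, fun c hc => ?_⟩
  · have hR : ∀ᶠ x in nhdsWithin x₀ (Icc α β), x₀ < x → c < growthRate P x := by
      rcases hx₀.2.eq_or_lt with h | h
      · filter_upwards [self_mem_nhdsWithin] with x hx hlt
        exact absurd hx.2 (h ▸ hlt.not_ge)
      · have h0 : 0 < β - x₀ := sub_pos.2 h
        filter_upwards [self_mem_nhdsWithin, hev β h0.ne' c hc] with x hx hcx hlt
        exact hcx.trans_le (hconc β ⟨hx₀.1.trans hx₀.2, le_rfl⟩ x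
          (div_nonneg (sub_nonneg.2 hx.2) h0.le) (div_nonneg (sub_nonneg.2 hlt.le) h0.le) h0.ne')
    have hL : ∀ᶠ x in nhdsWithin x₀ (Icc α β), x < x₀ → c < growthRate P x := by
      rcases hx₀.1.eq_or_lt with h | h
      · filter_upwards [self_mem_nhdsWithin] with x hx hlt
        exact absurd hx.1 (h ▸ hlt.not_ge)
      · have h0 : α - x₀ < 0 := sub_neg.2 h
        filter_upwards [self_mem_nhdsWithin, hev α h0.ne c hc] with x hx hcx hlt
        exact hcx.trans_le (hconc α ⟨le_rfl, hx₀.1.trans hx₀.2⟩ x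
          (div_nonneg_of_nonpos (sub_nonpos.2 hx.1) h0.le)
          (div_nonneg_of_nonpos (sub_nonpos.2 hlt.le) h0.le) h0.ne)
    filter_upwards [hR, hL] with x h1 h2
    rcases lt_trichotomy x x₀ with h | h | h
    · exact h2 h
    · exact h ▸ hc
    · exact h1 h
  · obtain ⟨s, hs⟩ := exists_lt_of_ciInf_lt hc
    have hcont : ContinuousAt (fun x => logPartition P s - s * x) x₀ := by fun_prop
    filter_upwards [self_mem_nhdsWithin, nhdsWithin_le_nhds (hcont.eventually_lt_const hs)]
      with x hx hlt
    exact (hle x hx s).trans_lt hlt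

theorem continuousOn_one_div_one_add : ContinuousOn (fun ρ : ℝ => 1 / (1 + ρ)) (Icc 0 1) :=
  continuousOn_const.div (by fun_prop) fun ρ hρ => by linarith [hρ.1]

theorem continuousOn_Es (hP : P ∈ stdSimplex ℝ U) : ContinuousOn (Es P) (Icc 0 1) := by
  rw [funext (Es_eq hP)]
  exact (by fun_prop : ContinuousOn (fun ρ : ℝ => 1 + ρ) (Icc 0 1)).mul
    ((continuous_logPartition hP).comp_continuousOn continuousOn_one_div_one_add)

theorem continuousOn_Esi_range (hP : P ∈ stdSimplex ℝ U) {a b : U} (ha : a ∈ supp P)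
    (hb : b ∈ supp P) (i : Fin 2) :
    ContinuousOn (fun p : ℝ × ℝ => Esi i p.1 P p.2) (Icc 0 1 ×ˢ Icc (P a) (P b)) := by
  set S : Set (ℝ × ℝ) := Icc 0 1 ×ˢ Icc (P a) (P b)
  have hpos : ∀ p ∈ S, 0 < p.2 := fun p hp => (supp_pos hP ha).trans_le hp.2.1
  have hlog : ContinuousOn (fun p : ℝ × ℝ => Real.log p.2) S :=
    continuousOn_snd.log fun p hp => (hpos p hp).ne'
  have hfst : MapsTo Prod.fst S (Icc (0 : ℝ) 1) := fun p hp => hp.1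
  have hEs : ContinuousOn (fun p : ℝ × ℝ => Es P p.1) S :=
    (continuousOn_Es hP).comp continuousOn_fst hfst
  have hm : ContinuousOn (fun p : ℝ × ℝ => tiltedMean P (1 / (1 + p.1))) S :=
    (continuous_tiltedMean hP).comp_continuousOn
      (continuousOn_one_div_one_add.comp continuousOn_fst hfst)
  have hline : ContinuousOn (fun p : ℝ × ℝ => rateLine P p.1 p.2) S := by
    unfold rateLine
    refine ((by fun_prop : ContinuousOn (fun p : ℝ × ℝ => 1 + p.1) S).mul ?_).add hlog
    exact (continuousOn_growthRate hP ha hb).comp hlog fun p hp =>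
      ⟨Real.log_le_log (supp_pos hP ha) hp.2.1, Real.log_le_log (hpos p hp) hp.2.2⟩
  rw [continuousOn_iff_continuous_domRestrict] at hlog hEs hm hline ⊢
  have h1 : ∀ p : S, (1 : ℝ) + p.1.1 ≠ 0 := fun p => by linarith [p.2.1.1]
  have hswitch : ∀ p : S, Real.log p.1.2 = tiltedMean P (1 / (1 + p.1.1)) →
      Es P p.1.1 = rateLine P p.1.1 p.1.2 := fun p h =>
    (rateLine_eq_Es hP (h1 p) h.symm).symm
  have hval := fun p : S => Esi_eq hP (h1 p) ha hb p.2.2.1 p.2.2.2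
  by_cases hi : i = 0
  · refine (continuous_coe_real_ereal.comp (Continuous.if_le hEs hline hlog hm hswitch)).congr
      fun p => ?_
    simp only [Function.comp, Esi, if_pos hi]
    split_ifs with h
    · exact ((hval p).1 h).1.symm
    · exact ((hval p).2 (le_of_not_ge h)).1.symm
  · refine (continuous_coe_real_ereal.comp
      (Continuous.if_le hline hEs hlog hm fun p h => (hswitch p h).symm)).congr fun p => ?_
    simp only [Function.comp, Esi, if_neg hi]
    split_ifs with h
    · exact ((hval p).1 h).2.symm
    · exact ((hval p).2 (le_of_not_ge h)).2.symm

theorem Esi_ne_top (i : Fin 2) (ρ : ℝ) (γ : ℝ) : Esi i ρ P γ ≠ ⊤ := by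
  unfold Esi Es1 Es2
  split_ifs <;> first | exact EReal.coe_ne_top _ | exact bot_ne_top

/-- All thresholds below the range of `P` are equivalent, and so are all thresholds above it.
Hence a compact set of thresholds, on which `E_{s,i}` is continuous, represents them all. -/
theorem exists_compact_thresholds (hP : P ∈ stdSimplex ℝ U) :
    ∃ K : Set ℝ, IsCompact K ∧ K.Nonempty ∧ K ⊆ Icc 0 1 ∧
      (∀ γ ∈ Icc (0 : ℝ) 1, ∃ γ' ∈ K, ∀ i ρ, Esi i ρ P γ' = Esi i ρ P γ) ∧
      ∀ i, ContinuousOn (fun p : ℝ × ℝ => Esi i p.1 P p.2) (Icc 0 1 ×ˢ K) := by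
  obtain ⟨a, ha, hamin⟩ := exists_min_letter hP
  obtain ⟨b, hb, hbmax⟩ := exists_max_letter hP
  have ha0 := supp_pos hP ha
  have hlow : ∀ γ < P a, ∀ u ∈ supp P, γ < P u := fun γ h u hu => h.trans_le (hamin u hu)
  have hhigh : ∀ γ > P b, ∀ u, P u < γ := fun γ h u => (hbmax u).trans_lt h
  have hb1 : P b ≤ 1 := by
    rw [← hP.2]
    exact Finset.single_le_sum (fun u _ => hP.1 u) (Finset.mem_univ b)
  have hconst : ∀ (K : Set ℝ) (_ : (∀ γ ∈ K, γ < P a) ∨ ∀ γ ∈ K, P b < γ) (i : Fin 2),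
      ContinuousOn (fun p : ℝ × ℝ => Esi i p.1 P p.2) (Icc 0 1 ×ˢ K) := by
    intro K hK i
    have hE : ContinuousOn (fun p : ℝ × ℝ => ((Es P p.1 : ℝ) : EReal)) (Icc 0 1 ×ˢ K) :=
      continuous_coe_real_ereal.comp_continuousOn
        ((continuousOn_Es hP).comp continuousOn_fst fun p hp => hp.1)
    rcases hK with hK | hK
    · by_cases hi : i = 0
      · refine hE.congr fun p hp => ?_
        simp only [Esi_of_lt_min (hlow _ (hK _ hp.2)), if_pos hi]
      · refine (continuousOn_const (c := (⊥ : EReal))).congr fun p hp => ?_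
        simp only [Esi_of_lt_min (hlow _ (hK _ hp.2)), if_neg hi]
    · by_cases hi : i = 0
      · refine (continuousOn_const (c := (⊥ : EReal))).congr fun p hp => ?_
        simp only [Esi_of_max_lt hP (hhigh _ (hK _ hp.2)), if_pos hi]
      · refine hE.congr fun p hp => ?_
        simp only [Esi_of_max_lt hP (hhigh _ (hK _ hp.2)), if_neg hi]
  have hfin : ({1} ∩ {_γ | P b < 1} : Set ℝ).Finite := (finite_singleton _).inter_of_left _
  refine ⟨({0} ∪ Icc (P a) (P b)) ∪ ({1} ∩ {_γ | P b < 1}),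
    (isCompact_singleton.union isCompact_Icc).union hfin.isCompact,
    ⟨0, Or.inl (Or.inl rfl)⟩, ?_, ?_, ?_⟩
  · rintro γ ((rfl | h) | h)
    · exact ⟨le_rfl, zero_le_one⟩
    · exact ⟨ha0.le.trans h.1, h.2.trans hb1⟩
    · rw [h.1]; exact ⟨zero_le_one, le_rfl⟩
  · intro γ hγ
    rcases lt_or_ge γ (P a) with h | h
    · refine ⟨0, Or.inl (Or.inl rfl), fun i ρ => ?_⟩
      rw [Esi_of_lt_min (hlow γ h), Esi_of_lt_min (hlow 0 ha0)]
    · rcases le_or_gt γ (P b) with h' | h'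
      · exact ⟨γ, Or.inl (Or.inr ⟨h, h'⟩), fun _ _ => rfl⟩
      · have h1 : P b < 1 := h'.trans_le hγ.2
        refine ⟨1, Or.inr ⟨rfl, h1⟩, fun i ρ => ?_⟩
        rw [Esi_of_max_lt hP (hhigh γ h'), Esi_of_max_lt hP (hhigh 1 h1)]
  · intro i
    rw [prod_union, prod_union]
    refine ((hconst _ (Or.inl ?_) i).union_of_isClosed (continuousOn_Esi_range hP ha hb i)
      ?_ ?_).union_of_isClosed (hconst _ (Or.inr ?_) i) ?_ ?_
    · rintro _ rfl; exact ha0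
    · exact isClosed_Icc.prod isClosed_singleton
    · exact isClosed_Icc.prod isClosed_Icc
    · rintro _ ⟨rfl, h⟩; exact h
    · exact (isClosed_Icc.prod isClosed_singleton).union (isClosed_Icc.prod isClosed_Icc)
    · exact isClosed_Icc.prod hfin.isClosed

end sourceContinuity

section channelContinuity

variable {X Z : Type*} [Fintype X] [Fintype Z]

theorem E0_sum_pos {Q : X → ℝ} {V : X → Z → ℝ} (hQ : ∀ x, 0 ≤ Q x) (hV : ∀ x z, 0 ≤ V x z)
    (h : ∃ x z, 0 < Q x ∧ 0 < V x z) (ρ : ℝ) :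
    0 < ∑ z, (∑ x, Q x * V x z ^ (1 / (1 + ρ))) ^ (1 + ρ) := by
  obtain ⟨x, z, hx, hz⟩ := h
  have hnn : ∀ x z, 0 ≤ Q x * V x z ^ (1 / (1 + ρ)) := fun x z =>
    mul_nonneg (hQ x) (Real.rpow_nonneg (hV x z) _)
  refine Finset.sum_pos' (fun z _ => Real.rpow_nonneg (Finset.sum_nonneg fun x _ => hnn x z) _)
    ⟨z, Finset.mem_univ z, Real.rpow_pos_of_pos (Finset.sum_pos' (fun x _ => hnn x z)
      ⟨x, Finset.mem_univ x, mul_pos hx (Real.rpow_pos_of_pos hz _)⟩) _⟩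

theorem continuousOn_E0 {Q : X → ℝ} {V : X → Z → ℝ} (hQ : ∀ x, 0 ≤ Q x) (hV : ∀ x z, 0 ≤ V x z)
    (h : ∃ x z, 0 < Q x ∧ 0 < V x z) : ContinuousOn (fun ρ => E0 ρ Q V) (Icc 0 1) := by
  unfold E0
  refine (ContinuousOn.log ?_ fun ρ _ => (E0_sum_pos hQ hV h ρ).ne').neg
  refine continuousOn_finsetSum _ fun z _ => ContinuousOn.rpow ?_ (by fun_prop) fun ρ hρ =>
    Or.inr (by linarith [hρ.1])
  refine continuousOn_finsetSum _ fun x _ => continuousOn_const.mul ?_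
  exact continuousOn_const.rpow continuousOn_one_div_one_add fun ρ hρ =>
    Or.inr (one_div_pos.2 (by linarith [hρ.1]))

end channelContinuity

/-! ### Attainment of the maxima -/

theorem ereal_continuousOn_sub {α : Type*} [TopologicalSpace α] {s : Set α} {f g : α → EReal}
    (hf : ContinuousOn f s) (hg : ContinuousOn g s) (hf' : ∀ x ∈ s, f x ≠ ⊥)
    (hg' : ∀ x ∈ s, g x ≠ ⊤) : ContinuousOn (fun x => f x - g x) s := by
  intro x hx
  have hneg : ContinuousWithinAt (fun x => -g x) s x :=
    continuous_neg.continuousAt.comp_continuousWithinAt (hg x hx)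
  have h0 : -g x ≠ ⊥ := by simpa using hg' x hx
  exact (EReal.continuousAt_add (p := (f x, -g x)) (Or.inr h0)
    (Or.inl (hf' x hx))).comp_continuousWithinAt (f := fun x => (f x, -g x)) ((hf x hx).prodMk hneg)

theorem ereal_continuousOn_add {α : Type*} [TopologicalSpace α] {s : Set α} {f g : α → EReal}
    (hf : ContinuousOn f s) (hg : ContinuousOn g s) (hf' : ∀ x ∈ s, f x ≠ ⊤)
    (hg' : ∀ x ∈ s, g x ≠ ⊤) : ContinuousOn (fun x => f x + g x) s := fun x hx =>
  (EReal.continuousAt_add (p := (f x, g x)) (Or.inl (hf' x hx))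
    (Or.inr (hg' x hx))).comp_continuousWithinAt (f := fun x => (f x, g x)) ((hf x hx).prodMk (hg x hx))

theorem ereal_sub_ne_bot {x y : EReal} (hx : x ≠ ⊥) (hy : y ≠ ⊤) : x - y ≠ ⊥ := by
  rw [sub_eq_add_neg]
  exact EReal.add_ne_bot_iff.2 ⟨hx, by simpa using hy⟩

theorem exists_pos_of_mem_stdSimplex {A : Type*} [Fintype A] {Q : A → ℝ}
    (hQ : Q ∈ stdSimplex ℝ A) : ∃ a, 0 < Q a := by
  obtain ⟨a, ha⟩ := supp_nonempty hQ
  exact ⟨a, supp_pos hQ ha⟩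

section attainment

variable {U₁ U₂ X₁ X₂ Y : Type*} [Fintype U₁] [Fintype U₂] [Fintype X₁] [Fintype X₂] [Fintype Y]
  {P₁ : U₁ → ℝ} {P₂ : U₂ → ℝ} {Q₁ : Fin 2 → X₁ → ℝ} {Q₂ : Fin 2 → X₂ → ℝ} {W : X₁ → X₂ → Y → ℝ}

theorem continuousOn_objective
    (hQ₁ : ∀ i, Q₁ i ∈ stdSimplex ℝ X₁) (hQ₂ : ∀ i, Q₂ i ∈ stdSimplex ℝ X₂)
    (hW : ∀ x₁ x₂, W x₁ x₂ ∈ stdSimplex ℝ Y) {K₁ K₂ : Set ℝ}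
    (h₁ : ∀ i, ContinuousOn (fun p : ℝ × ℝ => Esi i p.1 P₁ p.2) (Icc 0 1 ×ˢ K₁))
    (h₂ : ∀ i, ContinuousOn (fun p : ℝ × ℝ => Esi i p.1 P₂ p.2) (Icc 0 1 ×ˢ K₂))
    (τ : ErrType) (i₁ i₂ : Fin 2) :
    ContinuousOn (fun p : ℝ × ℝ × ℝ => objective P₁ P₂ Q₁ Q₂ W τ i₁ i₂ p.2.1 p.2.2 p.1)
      (Icc 0 1 ×ˢ K₁ ×ˢ K₂) := by
  set S : Set (ℝ × ℝ × ℝ) := Icc 0 1 ×ˢ K₁ ×ˢ K₂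
  have s₁ : ∀ i, ContinuousOn (fun p : ℝ × ℝ × ℝ => Esi i p.1 P₁ p.2.1) S := fun i =>
    (h₁ i).comp (f := fun p : ℝ × ℝ × ℝ => (p.1, p.2.1)) (by fun_prop) fun p hp => ⟨hp.1, hp.2.1⟩
  have s₂ : ∀ i, ContinuousOn (fun p : ℝ × ℝ × ℝ => Esi i p.1 P₂ p.2.2) S := fun i =>
    (h₂ i).comp (f := fun p : ℝ × ℝ × ℝ => (p.1, p.2.2)) (by fun_prop) fun p hp => ⟨hp.1, hp.2.2⟩
  have z₁ : ∀ i, ContinuousOn (fun p : ℝ × ℝ × ℝ => Esi i 0 P₁ p.2.1) S := fun i =>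
    (h₁ i).comp (f := fun p : ℝ × ℝ × ℝ => ((0 : ℝ), p.2.1)) (by fun_prop)
      fun p hp => ⟨⟨le_rfl, zero_le_one⟩, hp.2.1⟩
  have z₂ : ∀ i, ContinuousOn (fun p : ℝ × ℝ × ℝ => Esi i 0 P₂ p.2.2) S := fun i =>
    (h₂ i).comp (f := fun p : ℝ × ℝ × ℝ => ((0 : ℝ), p.2.2)) (by fun_prop)
      fun p hp => ⟨⟨le_rfl, zero_le_one⟩, hp.2.2⟩
  have hE : ∀ f : ℝ → ℝ, ContinuousOn f (Icc 0 1) →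
      ContinuousOn (fun p : ℝ × ℝ × ℝ => ((f p.1 : ℝ) : EReal)) S := fun f hf =>
    continuous_coe_real_ereal.comp_continuousOn (hf.comp continuousOn_fst fun p hp => hp.1)
  obtain ⟨x₁, hx₁⟩ := exists_pos_of_mem_stdSimplex (hQ₁ i₁)
  obtain ⟨x₂, hx₂⟩ := exists_pos_of_mem_stdSimplex (hQ₂ i₂)
  obtain ⟨y, hy⟩ := exists_pos_of_mem_stdSimplex (hW x₁ x₂)
  cases τ with
  | first =>
    refine ereal_continuousOn_sub (ereal_continuousOn_sub (hE _ (continuousOn_E0 (hQ₁ i₁).1 ?_ ?_))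
      (s₁ i₁) ?_ ?_) (z₂ i₂) ?_ ?_
    · exact fun x z => mul_nonneg ((hW _ _).1 _) ((hQ₂ i₂).1 _)
    · exact ⟨x₁, (x₂, y), hx₁, mul_pos hy hx₂⟩
    · exact fun _ _ => EReal.coe_ne_bot _
    · exact fun _ _ => Esi_ne_top _ _ _
    · exact fun _ _ => ereal_sub_ne_bot (EReal.coe_ne_bot _) (Esi_ne_top _ _ _)
    · exact fun _ _ => Esi_ne_top _ _ _
  | second =>
    refine ereal_continuousOn_sub (ereal_continuousOn_sub (hE _ (continuousOn_E0 (hQ₂ i₂).1 ?_ ?_))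
      (s₂ i₂) ?_ ?_) (z₁ i₁) ?_ ?_
    · exact fun x z => mul_nonneg ((hW _ _).1 _) ((hQ₁ i₁).1 _)
    · exact ⟨x₂, (x₁, y), hx₂, mul_pos hy hx₁⟩
    · exact fun _ _ => EReal.coe_ne_bot _
    · exact fun _ _ => Esi_ne_top _ _ _
    · exact fun _ _ => ereal_sub_ne_bot (EReal.coe_ne_bot _) (Esi_ne_top _ _ _)
    · exact fun _ _ => Esi_ne_top _ _ _
  | both =>
    refine ereal_continuousOn_sub (hE _ (continuousOn_E0 ?_ ?_ ?_))
      (ereal_continuousOn_add (s₁ i₁) (s₂ i₂) ?_ ?_) ?_ ?_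
    · exact fun x => mul_nonneg ((hQ₁ i₁).1 _) ((hQ₂ i₂).1 _)
    · exact fun x y => (hW _ _).1 _
    · exact ⟨(x₁, x₂), y, mul_pos hx₁ hx₂, hy⟩
    · exact fun _ _ => Esi_ne_top _ _ _
    · exact fun _ _ => Esi_ne_top _ _ _
    · exact fun _ _ => EReal.coe_ne_bot _
    · exact fun _ _ => EReal.add_ne_top (Esi_ne_top _ _ _) (Esi_ne_top _ _ _)

theorem objective_congr {γ₁ γ₂ γ₁' γ₂' : ℝ} (h₁ : ∀ i ρ, Esi i ρ P₁ γ₁' = Esi i ρ P₁ γ₁)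
    (h₂ : ∀ i ρ, Esi i ρ P₂ γ₂' = Esi i ρ P₂ γ₂) (τ : ErrType) (i₁ i₂ : Fin 2) (ρ : ℝ) :
    objective P₁ P₂ Q₁ Q₂ W τ i₁ i₂ γ₁' γ₂' ρ = objective P₁ P₂ Q₁ Q₂ W τ i₁ i₂ γ₁ γ₂ ρ := by
  cases τ <;> simp only [objective, h₁, h₂]

theorem exists_objective_eq_F (hP₁ : P₁ ∈ stdSimplex ℝ U₁) (hP₂ : P₂ ∈ stdSimplex ℝ U₂)
    (hQ₁ : ∀ i, Q₁ i ∈ stdSimplex ℝ X₁) (hQ₂ : ∀ i, Q₂ i ∈ stdSimplex ℝ X₂)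
    (hW : ∀ x₁ x₂, W x₁ x₂ ∈ stdSimplex ℝ Y) (τ : ErrType) (i₁ i₂ : Fin 2) {γ₁ γ₂ : ℝ}
    (hγ₁ : γ₁ ∈ Icc (0 : ℝ) 1) (hγ₂ : γ₂ ∈ Icc (0 : ℝ) 1) :
    ∃ ρ ∈ Icc (0 : ℝ) 1,
      objective P₁ P₂ Q₁ Q₂ W τ i₁ i₂ γ₁ γ₂ ρ = F P₁ P₂ Q₁ Q₂ W τ i₁ i₂ γ₁ γ₂ := by
  obtain ⟨K₁, -, -, -, hrep₁, hc₁⟩ := exists_compact_thresholds hP₁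
  obtain ⟨K₂, -, -, -, hrep₂, hc₂⟩ := exists_compact_thresholds hP₂
  obtain ⟨γ₁', hγ₁', e₁⟩ := hrep₁ γ₁ hγ₁
  obtain ⟨γ₂', hγ₂', e₂⟩ := hrep₂ γ₂ hγ₂
  have hcont : ContinuousOn (objective P₁ P₂ Q₁ Q₂ W τ i₁ i₂ γ₁ γ₂) (Icc 0 1) := by
    refine ((continuousOn_objective hQ₁ hQ₂ hW hc₁ hc₂ τ i₁ i₂).comp
      (f := fun ρ : ℝ => (ρ, γ₁', γ₂')) (by fun_prop) fun ρ hρ => ⟨hρ, hγ₁', hγ₂'⟩).congr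
      fun ρ _ => ?_
    exact (objective_congr e₁ e₂ τ i₁ i₂ ρ).symm
  obtain ⟨ρ, hρ, hmax⟩ := isCompact_Icc.exists_isMaxOn (nonempty_Icc.2 zero_le_one) hcont
  exact ⟨ρ, hρ, le_antisymm (le_iSup₂ (f := fun ρ (_ : ρ ∈ Icc (0 : ℝ) 1) =>
    objective P₁ P₂ Q₁ Q₂ W τ i₁ i₂ γ₁ γ₂ ρ) ρ hρ) (iSup₂_le fun r hr => hmax hr)⟩

theorem exists_thresholdExponent_eq (hP₁ : P₁ ∈ stdSimplex ℝ U₁) (hP₂ : P₂ ∈ stdSimplex ℝ U₂)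
    (hQ₁ : ∀ i, Q₁ i ∈ stdSimplex ℝ X₁) (hQ₂ : ∀ i, Q₂ i ∈ stdSimplex ℝ X₂)
    (hW : ∀ x₁ x₂, W x₁ x₂ ∈ stdSimplex ℝ Y) :
    ∃ γ₁ ∈ Icc (0 : ℝ) 1, ∃ γ₂ ∈ Icc (0 : ℝ) 1,
      thresholdExponent P₁ P₂ Q₁ Q₂ W γ₁ γ₂ = exponent P₁ P₂ Q₁ Q₂ W := by
  obtain ⟨K₁, hK₁, hne₁, hsub₁, hrep₁, hc₁⟩ := exists_compact_thresholds hP₁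
  obtain ⟨K₂, hK₂, hne₂, hsub₂, hrep₂, hc₂⟩ := exists_compact_thresholds hP₂
  have hF : ∀ τ i₁ i₂, Continuous fun p : ↥(K₁ ×ˢ K₂) =>
      F P₁ P₂ Q₁ Q₂ W τ i₁ i₂ p.1.1 p.1.2 := by
    intro τ i₁ i₂
    have hobj := continuousOn_objective hQ₁ hQ₂ hW hc₁ hc₂ τ i₁ i₂
    have h := IsCompact.continuous_sSup (K := (univ : Set (Icc (0 : ℝ) 1)))
      (f := fun (p : ↥(K₁ ×ˢ K₂)) (ρ : Icc (0 : ℝ) 1) =>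
        objective P₁ P₂ Q₁ Q₂ W τ i₁ i₂ p.1.1 p.1.2 ρ) isCompact_univ
      (hobj.comp_continuous (f := fun q : ↥(K₁ ×ˢ K₂) × Icc (0 : ℝ) 1 => (q.2.1, q.1.1))
        (by fun_prop) fun q => ⟨q.2.2, q.1.2⟩)
    refine h.congr fun p => ?_
    rw [image_univ, F, sSup_range, iSup_subtype]
  have hT : UpperSemicontinuous fun p : ↥(K₁ ×ˢ K₂) =>
      thresholdExponent P₁ P₂ Q₁ Q₂ W p.1.1 p.1.2 :=
    upperSemicontinuous_iInf fun τ => upperSemicontinuous_iInf fun i₁ =>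
      upperSemicontinuous_iInf fun i₂ => (hF τ i₁ i₂).upperSemicontinuous
  have : CompactSpace ↥(K₁ ×ˢ K₂) := isCompact_iff_compactSpace.1 (hK₁.prod hK₂)
  have : Nonempty ↥(K₁ ×ˢ K₂) := (hne₁.prod hne₂).to_subtype
  obtain ⟨⟨⟨γ₁, γ₂⟩, hγ⟩, -, hmax⟩ := (upperSemicontinuousOn_univ_iff.2 hT).exists_isMaxOn
    univ_nonempty isCompact_univ
  refine ⟨γ₁, hsub₁ hγ.1, γ₂, hsub₂ hγ.2, le_antisymm ?_ ?_⟩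
  · exact le_iSup₂_of_le γ₁ (hsub₁ hγ.1) (le_iSup₂_of_le γ₂ (hsub₂ hγ.2) le_rfl)
  · refine iSup₂_le fun a₁ ha₁ => iSup₂_le fun a₂ ha₂ => ?_
    obtain ⟨b₁, hb₁, e₁⟩ := hrep₁ a₁ ha₁
    obtain ⟨b₂, hb₂, e₂⟩ := hrep₂ a₂ ha₂
    have hb := hmax (mem_univ ⟨(b₁, b₂), hb₁, hb₂⟩)
    refine le_trans (le_of_eq ?_) hb
    simp only [thresholdExponent, F, objective_congr e₁ e₂]

end attainment

/-! ### The random coding bound for messages divided into classes -/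

/-- Jensen's inequality for the concave function `x ↦ x ^ r`, with unnormalized weights. -/
theorem sum_mul_rpow_le {Ω : Type*} [Fintype Ω] {w G : Ω → ℝ} {r g : ℝ} (hw : ∀ ω, 0 ≤ w ω)
    (hG : ∀ ω, 0 ≤ G ω) (hr0 : 0 ≤ r) (hr1 : r ≤ 1) (hg : ∑ ω, w ω * G ω = (∑ ω, w ω) * g) :
    ∑ ω, w ω * G ω ^ r ≤ (∑ ω, w ω) * g ^ r := by
  rcases (Finset.sum_nonneg fun ω (_ : ω ∈ Finset.univ) => hw ω).eq_or_lt with h0 | hpos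
  · have hz : ∀ ω, w ω = 0 := fun ω =>
      (Finset.sum_eq_zero_iff_of_nonneg fun ω _ => hw ω).1 h0.symm ω (Finset.mem_univ ω)
    simp [hz]
  · have h := (Real.concaveOn_rpow hr0 hr1).le_map_centerMass (t := Finset.univ) (w := w) (p := G)
      (fun ω _ => hw ω) hpos (fun ω _ => hG ω)
    simp only [Finset.centerMass, smul_eq_mul, Function.comp] at h
    rwa [hg, inv_mul_cancel_left₀ hpos.ne', inv_mul_le_iff₀ hpos] at h

/-- Young's inequality in the form in which it separates two message classes. -/
theorem mul_rpow_le_add {A B ρa ρb : ℝ} (hA : 0 ≤ A) (hB : 0 ≤ B) (ha : 0 ≤ ρa) :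
    A * B ^ ((1 + ρb) * ρa / (1 + ρa)) ≤ A ^ (1 + ρa) + B ^ (1 + ρb) := by
  have h1 : (0 : ℝ) < 1 + ρa := by linarith
  have hA' := Real.rpow_nonneg hA (1 + ρa)
  have hB' := Real.rpow_nonneg hB (1 + ρb)
  have h := Real.geom_mean_le_arith_mean2_weighted (w₁ := 1 / (1 + ρa)) (w₂ := ρa / (1 + ρa))
    (one_div_nonneg.2 h1.le) (div_nonneg ha h1.le) hA' hB' (by field_simp)
  rw [← Real.rpow_mul hA, ← Real.rpow_mul hB, mul_one_div_cancel h1.ne', Real.rpow_one,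
    ← mul_div_assoc] at h
  refine h.trans (add_le_add (mul_le_of_le_one_left hA' ?_) (mul_le_of_le_one_left hB' ?_))
  · rw [div_le_one h1]; linarith
  · rw [div_le_one h1]; linarith

/-- Gallager's bound on the indicator of the event that some competitor `v ∈ S` has a metric `μ v`
at least `x`; the exponents satisfy `1/(1+ρa) + r/(1+ρb) = 1`. -/
theorem le_mul_sum_rpow {M : Type*} {S : Finset M} {μ : M → ℝ} {x ρa ρb : ℝ} (hμ : ∀ v, 0 ≤ μ v)
    (hx : 0 ≤ x) (ha : 0 ≤ ρa) (hb : 0 ≤ ρb) {v : M} (hv : v ∈ S) (hxv : x ≤ μ v) :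
    x ≤ x ^ (1 / (1 + ρa)) *
      (∑ v ∈ S, μ v ^ (1 / (1 + ρb))) ^ ((1 + ρb) * ρa / (1 + ρa)) := by
  have h1 : (0 : ℝ) < 1 + ρa := by linarith
  have h2 : (0 : ℝ) < 1 + ρb := by linarith
  rcases hx.eq_or_lt with rfl | hpos
  · exact mul_nonneg (Real.rpow_nonneg le_rfl _) (Real.rpow_nonneg
      (Finset.sum_nonneg fun v _ => Real.rpow_nonneg (hμ v) _) _)
  · have h3 : x ^ (1 / (1 + ρb)) ≤ ∑ v ∈ S, μ v ^ (1 / (1 + ρb)) :=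
      (Real.rpow_le_rpow hx hxv (one_div_nonneg.2 h2.le)).trans
        (Finset.single_le_sum (f := fun v => μ v ^ (1 / (1 + ρb)))
          (fun v _ => Real.rpow_nonneg (hμ v) _) hv)
    have h4 := Real.rpow_le_rpow (Real.rpow_nonneg hx _) h3
      (div_nonneg (mul_nonneg h2.le ha) h1.le)
    rw [← Real.rpow_mul hx] at h4
    refine le_trans (le_of_eq ?_) (mul_le_mul_of_nonneg_left h4 (Real.rpow_nonneg hx _))
    rw [← Real.rpow_add hpos]
    have : 1 / (1 + ρa) + 1 / (1 + ρb) * ((1 + ρb) * ρa / (1 + ρa)) = 1 := by field_simp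
    rw [this, Real.rpow_one]

open Classical in
/-- The metric of the message `u` if some competitor of `u`, in the sense of the relation `R`, has a
metric at least as large, and `0` otherwise. Summed over messages and channel outputs, it bounds the
probability of an error in favour of a competitor. -/
def competitorLoss {M : Type*} (R : M → M → Prop) (μ : M → ℝ) (u : M) : ℝ :=
  if ∃ v, R u v ∧ μ u ≤ μ v then μ u else 0

/-- The random coding bound. `m ω u y` is the metric of the message `u` for the output `y` and the
code `ω`, which is drawn with the weights `w`; the metrics of a message and of its competitors are
uncorrelated. The exponent `ρ i` may depend on the class `i` of a message: if `u` has class `a`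
and its competitor `v` has class `b`, then `u` and `v` enter with the powers `1/(1+ρ a)` and
`1/(1+ρ b)`, which is possible since `ρ a * ρ b ≤ 1`. -/
theorem random_coding_bound {Ω M Y ι : Type*} [Fintype Ω] [Fintype M] [Fintype Y] [Fintype ι]
    [DecidableEq ι] {w : Ω → ℝ} (hw : ∀ ω, 0 ≤ w ω) {m : Ω → M → Y → ℝ} (hm : ∀ ω u y, 0 ≤ m ω u y)
    (cl : M → ι) {ρ : ι → ℝ} (hρ : ∀ i, ρ i ∈ Icc (0 : ℝ) 1) (R : M → M → Prop)
    (hind : ∀ u v, R u v → ∀ y, ∀ α β : ℝ, ∑ ω, w ω * (m ω u y ^ α * m ω v y ^ β)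
      = (∑ ω, w ω * m ω u y ^ α) * ∑ ω, w ω * m ω v y ^ β) :
    ∑ ω, w ω * ∑ u, ∑ y, competitorLoss R (fun v => m ω v y) u
      ≤ 2 * Fintype.card ι * ∑ i, ∑ y,
        (∑ u with cl u = i, ∑ ω, w ω * m ω u y ^ (1 / (1 + ρ i))) ^ (1 + ρ i) := by
  classical
  set A : ι → Y → ℝ := fun i y => ∑ u with cl u = i, ∑ ω, w ω * m ω u y ^ (1 / (1 + ρ i)) with hA
  set r : ι → ι → ℝ := fun a b => (1 + ρ b) * ρ a / (1 + ρ a) with hr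
  have hr0 : ∀ a b, 0 ≤ r a b := fun a b => by
    have := (hρ a).1; have := (hρ b).1; positivity
  have hr1 : ∀ a b, r a b ≤ 1 := fun a b => by
    have h1 := hρ a; have h2 := hρ b
    rw [hr, div_le_one (by linarith [h1.1])]
    nlinarith [h1.1, h1.2, h2.1, h2.2]
  have hE : ∀ (s : ℝ) u y, 0 ≤ ∑ ω, w ω * m ω u y ^ s := fun s u y =>
    Finset.sum_nonneg fun ω _ => mul_nonneg (hw ω) (Real.rpow_nonneg (hm ω u y) _)
  have hA0 : ∀ i y, 0 ≤ A i y := fun i y => Finset.sum_nonneg fun u _ => hE _ u y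
  have hpt : ∀ ω u y, competitorLoss R (fun v => m ω v y) u
      ≤ ∑ b, m ω u y ^ (1 / (1 + ρ (cl u))) *
        (∑ v with R u v ∧ cl v = b, m ω v y ^ (1 / (1 + ρ b))) ^ r (cl u) b := by
    intro ω u y
    have hnn : ∀ b, 0 ≤ m ω u y ^ (1 / (1 + ρ (cl u))) *
        (∑ v with R u v ∧ cl v = b, m ω v y ^ (1 / (1 + ρ b))) ^ r (cl u) b := fun b =>
      mul_nonneg (Real.rpow_nonneg (hm _ _ _) _) (Real.rpow_nonneg
        (Finset.sum_nonneg fun v _ => Real.rpow_nonneg (hm _ _ _) _) _)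
    unfold competitorLoss
    split_ifs with h
    · obtain ⟨v, hRv, hv⟩ := h
      refine (le_mul_sum_rpow (S := Finset.univ.filter fun v' => R u v' ∧ cl v' = cl v)
        (μ := fun v => m ω v y) (fun v => hm ω v y) (hm ω u y) (hρ (cl u)).1 (hρ (cl v)).1
        (v := v) (by simp [hRv]) hv).trans ?_
      exact Finset.single_le_sum (f := fun b => m ω u y ^ (1 / (1 + ρ (cl u))) *
        (∑ v with R u v ∧ cl v = b, m ω v y ^ (1 / (1 + ρ b))) ^ r (cl u) b)
        (fun b _ => hnn b) (Finset.mem_univ (cl v))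
    · exact Finset.sum_nonneg fun b _ => hnn b
  have hexp : ∀ u y b, ∑ ω, w ω * (m ω u y ^ (1 / (1 + ρ (cl u))) *
        (∑ v with R u v ∧ cl v = b, m ω v y ^ (1 / (1 + ρ b))) ^ r (cl u) b)
      ≤ (∑ ω, w ω * m ω u y ^ (1 / (1 + ρ (cl u)))) * A b y ^ r (cl u) b := by
    intro u y b
    have hJ := sum_mul_rpow_le (w := fun ω => w ω * m ω u y ^ (1 / (1 + ρ (cl u))))
      (G := fun ω => ∑ v with R u v ∧ cl v = b, m ω v y ^ (1 / (1 + ρ b)))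
      (g := ∑ v with R u v ∧ cl v = b, ∑ ω, w ω * m ω v y ^ (1 / (1 + ρ b)))
      (fun ω => mul_nonneg (hw ω) (Real.rpow_nonneg (hm _ _ _) _))
      (fun ω => Finset.sum_nonneg fun v _ => Real.rpow_nonneg (hm _ _ _) _)
      (hr0 (cl u) b) (hr1 (cl u) b) (by
        simp_rw [Finset.mul_sum]
        rw [Finset.sum_comm]
        refine Finset.sum_congr rfl fun v hv => ?_
        rw [← Finset.mul_sum, ← hind u v (Finset.mem_filter.1 hv).2.1]
        exact Finset.sum_congr rfl fun ω _ => by ring)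
    simp_rw [mul_assoc] at hJ
    refine hJ.trans (mul_le_mul_of_nonneg_left (Real.rpow_le_rpow
      (Finset.sum_nonneg fun v _ => hE _ v y) ?_ (hr0 _ _)) (hE _ u y))
    refine Finset.sum_le_sum_of_subset_of_nonneg (fun v hv => ?_) fun v _ _ => hE _ v y
    simp only [Finset.mem_filter] at hv ⊢
    exact ⟨hv.1, hv.2.2⟩
  calc ∑ ω, w ω * ∑ u, ∑ y, competitorLoss R (fun v => m ω v y) u
      ≤ ∑ ω, w ω * ∑ u, ∑ y, ∑ b, m ω u y ^ (1 / (1 + ρ (cl u))) *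
        (∑ v with R u v ∧ cl v = b, m ω v y ^ (1 / (1 + ρ b))) ^ r (cl u) b :=
        Finset.sum_le_sum fun ω _ => mul_le_mul_of_nonneg_left (Finset.sum_le_sum fun u _ =>
          Finset.sum_le_sum fun y _ => hpt ω u y) (hw ω)
    _ = ∑ y, ∑ b, ∑ u, ∑ ω, w ω * (m ω u y ^ (1 / (1 + ρ (cl u))) *
        (∑ v with R u v ∧ cl v = b, m ω v y ^ (1 / (1 + ρ b))) ^ r (cl u) b) := by
        simp_rw [Finset.mul_sum]
        rw [Finset.sum_comm]
        have h1 : ∀ u, ∑ ω, ∑ y, ∑ b, w ω * (m ω u y ^ (1 / (1 + ρ (cl u))) *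
            (∑ v with R u v ∧ cl v = b, m ω v y ^ (1 / (1 + ρ b))) ^ r (cl u) b)
            = ∑ y, ∑ b, ∑ ω, w ω * (m ω u y ^ (1 / (1 + ρ (cl u))) *
            (∑ v with R u v ∧ cl v = b, m ω v y ^ (1 / (1 + ρ b))) ^ r (cl u) b) := fun u => by
          rw [Finset.sum_comm]
          exact Finset.sum_congr rfl fun y _ => Finset.sum_comm
        simp_rw [h1]
        rw [Finset.sum_comm]
        exact Finset.sum_congr rfl fun y _ => Finset.sum_comm
    _ ≤ ∑ y, ∑ b, ∑ u, (∑ ω, w ω * m ω u y ^ (1 / (1 + ρ (cl u)))) * A b y ^ r (cl u) b :=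
        Finset.sum_le_sum fun y _ => Finset.sum_le_sum fun b _ => Finset.sum_le_sum fun u _ =>
          hexp u y b
    _ = ∑ y, ∑ b, ∑ a, A a y * A b y ^ r a b := by
        refine Finset.sum_congr rfl fun y _ => Finset.sum_congr rfl fun b _ => ?_
        rw [← Finset.sum_fiberwise (s := Finset.univ) (g := cl)]
        refine Finset.sum_congr rfl fun a _ => ?_
        rw [hA, Finset.sum_mul]
        refine Finset.sum_congr rfl fun u hu => ?_
        rw [(Finset.mem_filter.1 hu).2]
    _ ≤ ∑ y, ∑ b, ∑ a, (A a y ^ (1 + ρ a) + A b y ^ (1 + ρ b)) :=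
        Finset.sum_le_sum fun y _ => Finset.sum_le_sum fun b _ => Finset.sum_le_sum fun a _ =>
          mul_rpow_le_add (hA0 a y) (hA0 b y) (hρ a).1
    _ = 2 * Fintype.card ι * ∑ i, ∑ y, A i y ^ (1 + ρ i) := by
        rw [Finset.sum_comm (s := (Finset.univ : Finset ι)) (t := (Finset.univ : Finset Y)),
          Finset.mul_sum]
        refine Finset.sum_congr rfl fun y _ => ?_
        simp only [Finset.sum_add_distrib, Finset.sum_const, Finset.card_univ, nsmul_eq_mul,
          ← Finset.mul_sum]
        ring

/-! ### Marginals of independent codewords -/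

section marginals

variable {M X : Type*} [Fintype M] [DecidableEq M] [Fintype X] {q : M → X → ℝ}

theorem sum_prod_mul_mul (hq : ∀ m, ∑ x, q m x = 1) {m₀ m₁ : M} (hne : m₀ ≠ m₁) (f g : X → ℝ) :
    ∑ c : M → X, (∏ m, q m (c m)) * (f (c m₀) * g (c m₁))
      = (∑ x, q m₀ x * f x) * ∑ x, q m₁ x * g x := by
  have h1 : ∀ c : M → X, (∏ m, q m (c m)) * (f (c m₀) * g (c m₁))
      = ∏ m, q m (c m) * ((if m = m₀ then f (c m) else 1) * if m = m₁ then g (c m) else 1) := by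
    intro c
    rw [Finset.prod_mul_distrib, Finset.prod_mul_distrib, Finset.prod_ite_eq',
      Finset.prod_ite_eq', if_pos (Finset.mem_univ _), if_pos (Finset.mem_univ _)]
  have h2 := Finset.prod_univ_sum (fun _ : M => (Finset.univ : Finset X))
    (fun m x => q m x * ((if m = m₀ then f x else 1) * if m = m₁ then g x else 1))
  rw [Fintype.piFinset_univ] at h2
  simp_rw [h1]
  rw [← h2]
  have h3 : ∀ m, ∑ x, q m x * ((if m = m₀ then f x else 1) * if m = m₁ then g x else 1)
      = (if m = m₀ then ∑ x, q m x * f x else 1) * if m = m₁ then ∑ x, q m x * g x else 1 := by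
    intro m
    by_cases h0 : m = m₀
    · have : m ≠ m₁ := h0 ▸ hne
      simp [h0, hne]
    · by_cases h1 : m = m₁
      · simp [h1, hne.symm]
      · simp [h0, h1, hq]
  simp_rw [h3]
  rw [Finset.prod_mul_distrib, Finset.prod_ite_eq', Finset.prod_ite_eq',
    if_pos (Finset.mem_univ _), if_pos (Finset.mem_univ _)]

theorem sum_prod_mul (hq : ∀ m, ∑ x, q m x = 1) (m₀ : M) (f : X → ℝ) :
    ∑ c : M → X, (∏ m, q m (c m)) * f (c m₀) = ∑ x, q m₀ x * f x := by
  have h1 : ∀ c : M → X, (∏ m, q m (c m)) * f (c m₀)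
      = ∏ m, q m (c m) * (if m = m₀ then f (c m) else 1) := by
    intro c
    rw [Finset.prod_mul_distrib, Finset.prod_ite_eq', if_pos (Finset.mem_univ _)]
  have h2 := Finset.prod_univ_sum (fun _ : M => (Finset.univ : Finset X))
    (fun m x => q m x * (if m = m₀ then f x else 1))
  rw [Fintype.piFinset_univ] at h2
  simp_rw [h1]
  rw [← h2]
  have h3 : ∀ m, ∑ x, q m x * (if m = m₀ then f x else 1)
      = if m = m₀ then ∑ x, q m x * f x else 1 := by
    intro m
    by_cases h0 : m = m₀
    · simp [h0]
    · simp [h0, hq]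
  simp_rw [h3]
  rw [Finset.prod_ite_eq', if_pos (Finset.mem_univ _)]

theorem sum_prod_eq_one (hq : ∀ m, ∑ x, q m x = 1) : ∑ c : M → X, ∏ m, q m (c m) = 1 := by
  have h2 := Finset.prod_univ_sum (fun _ : M => (Finset.univ : Finset X)) q
  rw [Fintype.piFinset_univ] at h2
  rw [← h2]
  simp [hq]

variable {M' X' : Type*} [Fintype M'] [DecidableEq M'] [Fintype X'] {q' : M' → X' → ℝ}

theorem sum_sum_prod_mul (hq : ∀ m, ∑ x, q m x = 1) (hq' : ∀ m, ∑ x, q' m x = 1) (m₀ : M)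
    (m₀' : M') (f : X → X' → ℝ) :
    ∑ c : (M → X) × (M' → X'), ((∏ m, q m (c.1 m)) * ∏ m, q' m (c.2 m)) * f (c.1 m₀) (c.2 m₀')
      = ∑ x, ∑ x', q m₀ x * q' m₀' x' * f x x' := by
  rw [Fintype.sum_prod_type]
  simp_rw [mul_assoc, ← Finset.mul_sum]
  have h : ∀ c : M → X, ∑ c' : M' → X', (∏ m, q' m (c' m)) * f (c m₀) (c' m₀')
      = ∑ x', q' m₀' x' * f (c m₀) x' := fun c => sum_prod_mul hq' m₀' _
  simp_rw [h]
  exact sum_prod_mul hq m₀ fun x => ∑ x', q' m₀' x' * f x x'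

theorem sum_sum_prod_mul_mul (hq : ∀ m, ∑ x, q m x = 1) (hq' : ∀ m, ∑ x, q' m x = 1) {m₀ m₁ : M}
    (hne : m₀ ≠ m₁) {m₀' m₁' : M'} (hne' : m₀' ≠ m₁') (f g : X → X' → ℝ) :
    ∑ c : (M → X) × (M' → X'), ((∏ m, q m (c.1 m)) * ∏ m, q' m (c.2 m)) *
        (f (c.1 m₀) (c.2 m₀') * g (c.1 m₁) (c.2 m₁'))
      = (∑ x, ∑ x', q m₀ x * q' m₀' x' * f x x') * ∑ x, ∑ x', q m₁ x * q' m₁' x' * g x x' := by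
  rw [Fintype.sum_prod_type]
  simp_rw [mul_assoc, ← Finset.mul_sum]
  have h : ∀ c : M → X, ∑ c' : M' → X', (∏ m, q' m (c' m)) *
      (f (c m₀) (c' m₀') * g (c m₁) (c' m₁'))
      = (∑ x', q' m₀' x' * f (c m₀) x') * ∑ x', q' m₁' x' * g (c m₁) x' := fun c =>
    sum_prod_mul_mul hq' hne' _ _
  simp_rw [h]
  exact sum_prod_mul_mul hq hne (fun x => ∑ x', q' m₀' x' * f x x')
    fun x => ∑ x', q' m₁' x' * g x x'

end marginals

/-! ### Single-letter forms -/

theorem sum_seq_prod {A B : Type*} [Fintype A] [Fintype B] {n : ℕ}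
    (g : (Fin n → A) → (Fin n → B) → ℝ) :
    ∑ z : Fin n → A × B, g (fun l => (z l).1) (fun l => (z l).2) = ∑ a, ∑ b, g a b := by
  rw [← Fintype.sum_prod_type']
  exact Equiv.sum_comp (Equiv.arrowProdEquivProdArrow (Fin n) (fun _ => A) (fun _ => B))
    fun p => g p.1 p.2

theorem sum_seqProb {A : Type*} [Fintype A] {Q : A → ℝ} (hQ : Q ∈ stdSimplex ℝ A) (n : ℕ) :
    ∑ a : Fin n → A, seqProb Q a = 1 := by
  simp only [seqProb]
  rw [sum_prod_seq, hQ.2, one_pow]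

/-- `E_0` is additive for memoryless channels and i.i.d. inputs. -/
theorem sum_seq_eq_exp_E0 {X Z : Type*} [Fintype X] [Fintype Z] {Q : X → ℝ} {V : X → Z → ℝ}
    (hQ : ∀ x, 0 ≤ Q x) (hV : ∀ x z, 0 ≤ V x z) (h : ∃ x z, 0 < Q x ∧ 0 < V x z) (ρ : ℝ) (n : ℕ) :
    ∑ z : Fin n → Z, (∑ x : Fin n → X,
        seqProb Q x * (∏ l, V (x l) (z l)) ^ (1 / (1 + ρ))) ^ (1 + ρ)
      = Real.exp (-(n * E0 ρ Q V)) := by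
  classical
  have h1 : ∀ z : Fin n → Z, (∑ x : Fin n → X,
      seqProb Q x * (∏ l, V (x l) (z l)) ^ (1 / (1 + ρ))) ^ (1 + ρ)
      = ∏ l, (∑ x, Q x * V x (z l) ^ (1 / (1 + ρ))) ^ (1 + ρ) := by
    intro z
    rw [Real.finsetProd_rpow _ _ fun l _ => Finset.sum_nonneg fun x _ =>
      mul_nonneg (hQ x) (Real.rpow_nonneg (hV _ _) _)]
    congr 1
    have h2 := Finset.prod_univ_sum (fun _ : Fin n => (Finset.univ : Finset X))
      (fun l x => Q x * V x (z l) ^ (1 / (1 + ρ)))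
    rw [Fintype.piFinset_univ] at h2
    rw [h2]
    refine Finset.sum_congr rfl fun x _ => ?_
    rw [Finset.prod_mul_distrib, seqProb, Real.finsetProd_rpow _ _ fun l _ => hV _ _]
  simp_rw [h1]
  rw [sum_prod_seq (fun z => (∑ x, Q x * V x z ^ (1 / (1 + ρ))) ^ (1 + ρ)), E0, mul_neg, neg_neg,
    Real.exp_nat_mul, Real.exp_log (E0_sum_pos hQ hV h ρ)]

/-! ### The three types of errors -/

/-- `E_{s,i}` is never `+∞`, so that a strict lower bound on the objective function leaves room for
real upper bounds on the source terms. -/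
theorem exists_real_of_lt_sub {a A : ℝ} {x y : EReal} (hx : x ≠ ⊤) (hy : y ≠ ⊤)
    (h : (a : EReal) < (A : EReal) - x - y) :
    ∃ e₁ e₂ : ℝ, x < e₁ ∧ y < e₂ ∧ a ≤ A - e₁ - e₂ := by
  induction x with
  | top => exact absurd rfl hx
  | bot =>
    induction y with
    | top => exact absurd rfl hy
    | bot => exact ⟨A - a, 0, EReal.bot_lt_coe _, EReal.bot_lt_coe _, by linarith⟩
    | coe y => exact ⟨A - a - (y + 1), y + 1, EReal.bot_lt_coe _, by exact_mod_cast lt_add_one y,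
        by linarith⟩
  | coe x =>
    induction y with
    | top => exact absurd rfl hy
    | bot => exact ⟨x + 1, A - a - (x + 1), by exact_mod_cast lt_add_one x, EReal.bot_lt_coe _,
        by linarith⟩
    | coe y =>
      have h' : a < A - x - y := by exact_mod_cast h
      refine ⟨x + (A - x - y - a) / 2, y + (A - x - y - a) / 2, ?_, ?_, by linarith⟩
      · exact_mod_cast (by linarith : x < x + (A - x - y - a) / 2)
      · exact_mod_cast (by linarith : y < y + (A - x - y - a) / 2)

theorem chanProb_nonneg {X₁ X₂ Y : Type*} {W : X₁ → X₂ → Y → ℝ} (hW : ∀ x₁ x₂ y, 0 ≤ W x₁ x₂ y)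
    {n : ℕ} (x₁ : Fin n → X₁) (x₂ : Fin n → X₂) (y : Fin n → Y) : 0 ≤ chanProb W x₁ x₂ y :=
  Finset.prod_nonneg fun _ _ => hW _ _ _

theorem ite_le_ite_add {e p q r : Prop} {_ : Decidable e} {_ : Decidable p} {_ : Decidable q}
    {_ : Decidable r} {x : ℝ} (hx : 0 ≤ x) (h : e → p ∨ q ∨ r) :
    (if e then x else 0) ≤ (if p then x else 0) + (if q then x else 0) + if r then x else 0 := by
  have hite : ∀ (p : Prop) [Decidable p], 0 ≤ if p then x else 0 := fun p _ => by
    split_ifs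
    · exact hx
    · exact le_rfl
  by_cases he : e
  · rw [if_pos he]
    rcases h he with h | h | h
    · rw [if_pos h]; linarith [hite q, hite r]
    · rw [if_pos h]; linarith [hite p, hite r]
    · rw [if_pos h]; linarith [hite p, hite q]
  · rw [if_neg he]
    exact add_nonneg (add_nonneg (hite p) (hite q)) (hite r)

section metric

variable {U₁ U₂ X₁ X₂ Y : Type*} {P₁ : U₁ → ℝ} {P₂ : U₂ → ℝ} {W : X₁ → X₂ → Y → ℝ}

theorem metric_nonneg (hP₁ : ∀ u, 0 ≤ P₁ u) (hP₂ : ∀ u, 0 ≤ P₂ u) (hW : ∀ x₁ x₂ y, 0 ≤ W x₁ x₂ y)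
    {n : ℕ} (c₁ : Codebook U₁ X₁ n) (c₂ : Codebook U₂ X₂ n) (y : Fin n → Y)
    (u : (Fin n → U₁) × (Fin n → U₂)) : 0 ≤ metric P₁ P₂ W c₁ c₂ y u :=
  mul_nonneg (mul_nonneg (seqProb_nonneg hP₁ _) (seqProb_nonneg hP₂ _)) (chanProb_nonneg hW _ _ _)

theorem metric_swap {n : ℕ} (c₁ : Codebook U₁ X₁ n) (c₂ : Codebook U₂ X₂ n) (y : Fin n → Y)
    (u₁ : Fin n → U₁) (u₂ : Fin n → U₂) :
    metric P₂ P₁ (fun x₂ x₁ => W x₁ x₂) c₂ c₁ y (u₂, u₁) = metric P₁ P₂ W c₁ c₂ y (u₁, u₂) := by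
  simp only [metric, chanProb]
  ring

open Classical in
theorem errorProb_eq_sum_metric [Fintype U₁] [Fintype U₂] [Fintype Y] {n : ℕ}
    (c₁ : Codebook U₁ X₁ n) (c₂ : Codebook U₂ X₂ n)
    (d : Decoder U₁ U₂ Y n) :
    errorProb P₁ P₂ W c₁ c₂ d = ∑ u : (Fin n → U₁) × (Fin n → U₂), ∑ y : Fin n → Y,
      if d y ≠ u then metric P₁ P₂ W c₁ c₂ y u else 0 := by
  rw [errorProb, Fintype.sum_prod_type]
  refine Finset.sum_congr rfl fun u₁ _ => Finset.sum_congr rfl fun u₂ _ => ?_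
  rw [Finset.mul_sum]
  refine Finset.sum_congr rfl fun y _ => ?_
  split_ifs <;> simp [metric]

end metric

section errors

variable {U₁ U₂ X₁ X₂ Y : Type*} [Fintype U₁] [Fintype U₂] [Fintype Y]
  {P₁ : U₁ → ℝ} {P₂ : U₂ → ℝ} {W : X₁ → X₂ → Y → ℝ}

/-- The part of the error probability due to competitors that differ in the first message only. -/
def firstErr (P₁ : U₁ → ℝ) (P₂ : U₂ → ℝ) (W : X₁ → X₂ → Y → ℝ) {n : ℕ}
    (c₁ : Codebook U₁ X₁ n) (c₂ : Codebook U₂ X₂ n) : ℝ :=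
  ∑ u₂ : Fin n → U₂, ∑ u₁ : Fin n → U₁, ∑ y : Fin n → Y,
    competitorLoss (· ≠ ·) (fun u => metric P₁ P₂ W c₁ c₂ y (u, u₂)) u₁

/-- The part of the error probability due to competitors that differ in both messages. -/
def bothErr (P₁ : U₁ → ℝ) (P₂ : U₂ → ℝ) (W : X₁ → X₂ → Y → ℝ) {n : ℕ}
    (c₁ : Codebook U₁ X₁ n) (c₂ : Codebook U₂ X₂ n) : ℝ :=
  ∑ u : (Fin n → U₁) × (Fin n → U₂), ∑ y : Fin n → Y,
    competitorLoss (fun u v => u.1 ≠ v.1 ∧ u.2 ≠ v.2) (metric P₁ P₂ W c₁ c₂ y) u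

/-- Union bound over the three types of errors. -/
theorem errorProb_le (hP₁ : ∀ u, 0 ≤ P₁ u) (hP₂ : ∀ u, 0 ≤ P₂ u) (hW : ∀ x₁ x₂ y, 0 ≤ W x₁ x₂ y)
    {n : ℕ} {c₁ : Codebook U₁ X₁ n} {c₂ : Codebook U₂ X₂ n} {d : Decoder U₁ U₂ Y n}
    (hd : IsMAP P₁ P₂ W c₁ c₂ d) :
    errorProb P₁ P₂ W c₁ c₂ d ≤ firstErr P₁ P₂ W c₁ c₂
      + firstErr P₂ P₁ (fun x₂ x₁ => W x₁ x₂) c₂ c₁ + bothErr P₁ P₂ W c₁ c₂ := by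
  have e1 : firstErr P₁ P₂ W c₁ c₂ = ∑ u : (Fin n → U₁) × (Fin n → U₂), ∑ y : Fin n → Y,
      competitorLoss (· ≠ ·) (fun v => metric P₁ P₂ W c₁ c₂ y (v, u.2)) u.1 := by
    rw [Fintype.sum_prod_type_right, firstErr]
  have e2 : firstErr P₂ P₁ (fun x₂ x₁ => W x₁ x₂) c₂ c₁
      = ∑ u : (Fin n → U₁) × (Fin n → U₂), ∑ y : Fin n → Y,
      competitorLoss (· ≠ ·) (fun v => metric P₁ P₂ W c₁ c₂ y (u.1, v)) u.2 := by
    rw [Fintype.sum_prod_type, firstErr]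
    simp_rw [metric_swap]
  rw [errorProb_eq_sum_metric, e1, e2, bothErr, ← Finset.sum_add_distrib, ← Finset.sum_add_distrib]
  refine Finset.sum_le_sum fun u _ => ?_
  rw [← Finset.sum_add_distrib, ← Finset.sum_add_distrib]
  refine Finset.sum_le_sum fun y _ => ?_
  refine ite_le_ite_add (metric_nonneg hP₁ hP₂ hW c₁ c₂ y u) fun hdu => ?_
  have hle := hd y u
  by_cases h1 : u.1 = (d y).1
  · have h2 : u.2 ≠ (d y).2 := fun h2 => hdu (Prod.ext h1 h2).symm
    exact Or.inr (Or.inl ⟨(d y).2, h2, by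
      change metric P₁ P₂ W c₁ c₂ y u ≤ metric P₁ P₂ W c₁ c₂ y (u.1, (d y).2)
      rw [h1]; exact hle⟩)
  · by_cases h2 : u.2 = (d y).2
    · exact Or.inl ⟨(d y).1, h1, by
        change metric P₁ P₂ W c₁ c₂ y u ≤ metric P₁ P₂ W c₁ c₂ y ((d y).1, u.2)
        rw [h2]; exact hle⟩
    · exact Or.inr (Or.inr ⟨d y, ⟨h1, h2⟩, hle⟩)

/-- All MAP decoders have the same error probability. -/
theorem errorProb_eq_of_isMAP {n : ℕ} {c₁ : Codebook U₁ X₁ n} {c₂ : Codebook U₂ X₂ n}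
    {d d' : Decoder U₁ U₂ Y n} (hd : IsMAP P₁ P₂ W c₁ c₂ d) (hd' : IsMAP P₁ P₂ W c₁ c₂ d') :
    errorProb P₁ P₂ W c₁ c₂ d = errorProb P₁ P₂ W c₁ c₂ d' := by
  classical
  have h : ∀ d : Decoder U₁ U₂ Y n, errorProb P₁ P₂ W c₁ c₂ d = ∑ y : Fin n → Y,
      (∑ u, metric P₁ P₂ W c₁ c₂ y u - metric P₁ P₂ W c₁ c₂ y (d y)) := by
    intro d
    rw [errorProb_eq_sum_metric, Finset.sum_comm]
    refine Finset.sum_congr rfl fun y _ => ?_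
    rw [← Finset.add_sum_erase _ _ (Finset.mem_univ (d y)),
      ← Finset.add_sum_erase _ (fun u => metric P₁ P₂ W c₁ c₂ y u) (Finset.mem_univ (d y))]
    simp only [ne_eq, not_true_eq_false, if_false, zero_add, add_sub_cancel_left]
    refine Finset.sum_congr rfl fun u hu => ?_
    rw [if_pos fun h => Finset.ne_of_mem_erase hu h.symm]
  rw [h, h]
  refine Finset.sum_congr rfl fun y _ => ?_
  rw [le_antisymm (hd' y (d y)) (hd y (d' y))]

end errors

/-! ### The ensemble average of each type of error -/

section ensemble

variable {U₁ U₂ X₁ X₂ Y : Type*} [Fintype U₁] [Fintype U₂] [Fintype X₁] [Fintype X₂] [Fintype Y]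
  {P₁ : U₁ → ℝ} {P₂ : U₂ → ℝ} {Q₁ : Fin 2 → X₁ → ℝ} {Q₂ : Fin 2 → X₂ → ℝ} {W : X₁ → X₂ → Y → ℝ}

theorem codebookProb_nonneg (hQ₁ : ∀ i, Q₁ i ∈ stdSimplex ℝ X₁) {γ : ℝ} {n : ℕ}
    (c : Codebook U₁ X₁ n) : 0 ≤ codebookProb P₁ Q₁ γ c :=
  Finset.prod_nonneg fun _ _ => seqProb_nonneg (hQ₁ _).1 _

/-- With the second message and its codeword fixed, the first user faces a point-to-point channel;
the average over them contributes the factor `∑ P₂ⁿ(u₂)` over the class of `u₂`, which is the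
source of the term `E_{s,i₂}(0, P₂, γ₂)`. -/
theorem sum_firstErr_le (hP₁ : P₁ ∈ stdSimplex ℝ U₁) (hP₂ : P₂ ∈ stdSimplex ℝ U₂)
    (hQ₁ : ∀ i, Q₁ i ∈ stdSimplex ℝ X₁) (hQ₂ : ∀ i, Q₂ i ∈ stdSimplex ℝ X₂)
    (hW : ∀ x₁ x₂, W x₁ x₂ ∈ stdSimplex ℝ Y) {γ₁ γ₂ a : ℝ} (hγ₁ : 0 ≤ γ₁) (hγ₂ : 0 ≤ γ₂)
    (ha : ∀ i₁ i₂, (a : EReal) < F P₁ P₂ Q₁ Q₂ W .first i₁ i₂ γ₁ γ₂) (n : ℕ)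
    [DecidableEq (Fin n → U₁)] [DecidableEq (Fin n → U₂)] :
    ∑ c₁ : Codebook U₁ X₁ n, ∑ c₂ : Codebook U₂ X₂ n,
      codebookProb P₁ Q₁ γ₁ c₁ * codebookProb P₂ Q₂ γ₂ c₂ * firstErr P₁ P₂ W c₁ c₂
      ≤ 16 * Real.exp (-(n * a)) := by
  have hch : ∀ i₁ i₂, ∃ ρ ∈ Icc (0 : ℝ) 1, ∃ e₁ e₂ : ℝ, Esi i₁ ρ P₁ γ₁ < e₁ ∧ Esi i₂ 0 P₂ γ₂ < e₂ ∧
      a ≤ E0 ρ (Q₁ i₁) (fun (x₁ : X₁) (z : X₂ × Y) => W x₁ z.1 z.2 * Q₂ i₂ z.1) - e₁ - e₂ := by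
    intro i₁ i₂
    have h := ha i₁ i₂
    simp only [F, lt_iSup_iff] at h
    obtain ⟨ρ, hρ, h⟩ := h
    exact ⟨ρ, hρ, exists_real_of_lt_sub (Esi_ne_top _ _ _) (Esi_ne_top _ _ _) h⟩
  choose ρ hρ e₁ e₂ he₁ he₂ hae using hch
  set q₁ : (Fin n → U₁) → (Fin n → X₁) → ℝ := fun u => seqProb (Q₁ (msgClass P₁ γ₁ u)) with hq₁
  set q₂ : (Fin n → U₂) → (Fin n → X₂) → ℝ := fun u => seqProb (Q₂ (msgClass P₂ γ₂ u)) with hq₂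
  have hs₁ : ∀ u, ∑ x, q₁ u x = 1 := fun u => sum_seqProb (hQ₁ _) n
  have hs₂ : ∀ u, ∑ x, q₂ u x = 1 := fun u => sum_seqProb (hQ₂ _) n
  have hW0 : ∀ x₁ x₂ y, 0 ≤ W x₁ x₂ y := fun x₁ x₂ => (hW x₁ x₂).1
  -- The two factors of the averaged metric of class `i`: the source and the channel.
  set S : Fin 2 → Fin 2 → ℝ := fun i j =>
    ∑ u : Fin n → U₁ with msgClass P₁ γ₁ u = i, seqProb P₁ u ^ (1 / (1 + ρ i j)) with hS
  set B : Fin 2 → Fin 2 → (Fin n → X₂) → (Fin n → Y) → ℝ := fun i j x₂ y =>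
    ∑ x₁ : Fin n → X₁, seqProb (Q₁ i) x₁ * chanProb W x₁ x₂ y ^ (1 / (1 + ρ i j)) with hB
  have hS0 : ∀ i j, 0 ≤ S i j := fun i j => Finset.sum_nonneg fun u _ =>
    Real.rpow_nonneg (seqProb_nonneg hP₁.1 u) _
  have hB0 : ∀ i j x₂ y, 0 ≤ B i j x₂ y := fun i j x₂ y => Finset.sum_nonneg fun x _ =>
    mul_nonneg (seqProb_nonneg (hQ₁ i).1 x) (Real.rpow_nonneg (chanProb_nonneg hW0 _ _ _) _)
  have hρ1 : ∀ i j, (0 : ℝ) < 1 + ρ i j := fun i j => by linarith [(hρ i j).1]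
  have hfix : ∀ (c₂ : Codebook U₂ X₂ n) (u₂ : Fin n → U₂),
      ∑ c₁ : Codebook U₁ X₁ n, codebookProb P₁ Q₁ γ₁ c₁ * ∑ u₁ : Fin n → U₁, ∑ y : Fin n → Y,
        competitorLoss (· ≠ ·) (fun u => metric P₁ P₂ W c₁ c₂ y (u, u₂)) u₁
      ≤ 4 * ∑ i, S i (msgClass P₂ γ₂ u₂) ^ (1 + ρ i (msgClass P₂ γ₂ u₂)) * seqProb P₂ u₂ *
        ∑ y, B i (msgClass P₂ γ₂ u₂) (c₂ u₂) y ^ (1 + ρ i (msgClass P₂ γ₂ u₂)) := by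
    intro c₂ u₂
    set j := msgClass P₂ γ₂ u₂
    have key := random_coding_bound (w := fun c₁ : Codebook U₁ X₁ n => codebookProb P₁ Q₁ γ₁ c₁)
      (fun c => codebookProb_nonneg hQ₁ c)
      (m := fun c₁ u₁ y => metric P₁ P₂ W c₁ c₂ y (u₁, u₂))
      (fun c₁ u₁ y => metric_nonneg hP₁.1 hP₂.1 hW0 _ _ _ _) (msgClass P₁ γ₁) (ρ := fun i => ρ i j)
      (fun i => hρ i j) (fun u v => u ≠ v) (fun u v huv y α β => by
        have e := sum_prod_mul_mul (q := q₁) hs₁ huv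
          (fun x => (seqProb P₁ u * seqProb P₂ u₂ * chanProb W x (c₂ u₂) y) ^ α)
          (fun x => (seqProb P₁ v * seqProb P₂ u₂ * chanProb W x (c₂ u₂) y) ^ β)
        have f1 := sum_prod_mul (q := q₁) hs₁ u
          (fun x => (seqProb P₁ u * seqProb P₂ u₂ * chanProb W x (c₂ u₂) y) ^ α)
        have f2 := sum_prod_mul (q := q₁) hs₁ v
          (fun x => (seqProb P₁ v * seqProb P₂ u₂ * chanProb W x (c₂ u₂) y) ^ β)
        rw [← f1, ← f2] at e
        exact e)
    have hcard : (2 * (Fintype.card (Fin 2) : ℝ)) = 4 := by norm_num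
    rw [hcard] at key
    refine key.trans (le_of_eq ?_)
    congr 1
    refine Finset.sum_congr rfl fun i _ => ?_
    rw [Finset.mul_sum]
    refine Finset.sum_congr rfl fun y _ => ?_
    have hA : ∑ u : Fin n → U₁ with msgClass P₁ γ₁ u = i, ∑ c₁ : Codebook U₁ X₁ n,
        codebookProb P₁ Q₁ γ₁ c₁ * metric P₁ P₂ W c₁ c₂ y (u, u₂) ^ (1 / (1 + ρ i j))
        = S i j * (seqProb P₂ u₂ ^ (1 / (1 + ρ i j)) * B i j (c₂ u₂) y) := by
      rw [hS, Finset.sum_mul]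
      refine Finset.sum_congr rfl fun u hu => ?_
      have f1 := sum_prod_mul (q := q₁) hs₁ u
          (fun x => (seqProb P₁ u * seqProb P₂ u₂ * chanProb W x (c₂ u₂) y) ^ (1 / (1 + ρ i j)))
      refine Eq.trans f1 ?_
      rw [hB, Finset.mul_sum, Finset.mul_sum]
      refine Finset.sum_congr rfl fun x _ => ?_
      rw [Real.mul_rpow (mul_nonneg (seqProb_nonneg hP₁.1 _) (seqProb_nonneg hP₂.1 _))
        (chanProb_nonneg hW0 _ _ _), Real.mul_rpow (seqProb_nonneg hP₁.1 _)
        (seqProb_nonneg hP₂.1 _), hq₁, ← (Finset.mem_filter.1 hu).2]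
      ring
    rw [hA, Real.mul_rpow (hS0 i j) (mul_nonneg (Real.rpow_nonneg (seqProb_nonneg hP₂.1 _) _)
      (hB0 _ _ _ _)), Real.mul_rpow (Real.rpow_nonneg (seqProb_nonneg hP₂.1 _) _) (hB0 _ _ _ _),
      ← Real.rpow_mul (seqProb_nonneg hP₂.1 _), one_div_mul_cancel (hρ1 i j).ne', Real.rpow_one,
      mul_assoc]
  have hchan : ∀ i j, ∑ x₂ : Fin n → X₂, seqProb (Q₂ j) x₂ * ∑ y, B i j x₂ y ^ (1 + ρ i j)
      = Real.exp (-(n * E0 (ρ i j) (Q₁ i)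
        (fun (x₁ : X₁) (z : X₂ × Y) => W x₁ z.1 z.2 * Q₂ j z.1))) := by
    intro i j
    obtain ⟨x₁, hx₁⟩ := exists_pos_of_mem_stdSimplex (hQ₁ i)
    obtain ⟨x₂, hx₂⟩ := exists_pos_of_mem_stdSimplex (hQ₂ j)
    obtain ⟨y, hy⟩ := exists_pos_of_mem_stdSimplex (hW x₁ x₂)
    rw [← sum_seq_eq_exp_E0 (V := fun (x₁ : X₁) (z : X₂ × Y) => W x₁ z.1 z.2 * Q₂ j z.1)
      (hQ₁ i).1 (fun x z => mul_nonneg (hW0 _ _ _) ((hQ₂ j).1 _))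
      ⟨x₁, (x₂, y), hx₁, mul_pos hy hx₂⟩]
    simp_rw [Finset.mul_sum]
    rw [← sum_seq_prod (fun x₂ y => seqProb (Q₂ j) x₂ * B i j x₂ y ^ (1 + ρ i j))]
    refine Finset.sum_congr rfl fun z _ => ?_
    have hq0 := seqProb_nonneg (hQ₂ j).1 (fun l => (z l).1)
    have e : ∑ x : Fin n → X₁, seqProb (Q₁ i) x *
        (∏ l, W (x l) (z l).1 (z l).2 * Q₂ j (z l).1) ^ (1 / (1 + ρ i j))
        = seqProb (Q₂ j) (fun l => (z l).1) ^ (1 / (1 + ρ i j)) *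
          B i j (fun l => (z l).1) (fun l => (z l).2) := by
      rw [hB, Finset.mul_sum]
      refine Finset.sum_congr rfl fun x _ => ?_
      rw [Finset.prod_mul_distrib, Real.mul_rpow (Finset.prod_nonneg fun l _ => hW0 _ _ _)
        (Finset.prod_nonneg fun l _ => (hQ₂ j).1 _)]
      simp only [chanProb, seqProb]
      ring
    rw [e, Real.mul_rpow (Real.rpow_nonneg hq0 _) (hB0 _ _ _ _), ← Real.rpow_mul hq0,
      one_div_mul_cancel (hρ1 i j).ne', Real.rpow_one]
  have hterm : ∀ i j, S i j ^ (1 + ρ i j) *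
      (∑ u₂ : Fin n → U₂ with msgClass P₂ γ₂ u₂ = j, seqProb P₂ u₂) *
      Real.exp (-(n * E0 (ρ i j) (Q₁ i) (fun (x₁ : X₁) (z : X₂ × Y) => W x₁ z.1 z.2 * Q₂ j z.1)))
      ≤ Real.exp (-(n * a)) := by
    intro i j
    have h1 := class_sum_le hP₁ (hρ i j).1 hγ₁ (he₁ i j) n
    have h2 := class_sum_le hP₂ le_rfl hγ₂ (he₂ i j) n
    simp only [add_zero, div_one, Real.rpow_one] at h2
    refine (mul_le_mul_of_nonneg_right (mul_le_mul h1 h2 (Finset.sum_nonneg fun u _ =>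
      seqProb_nonneg hP₂.1 u) (Real.exp_nonneg _)) (Real.exp_nonneg _)).trans ?_
    rw [← Real.exp_add, ← Real.exp_add]
    refine Real.exp_le_exp.2 ?_
    have := mul_le_mul_of_nonneg_left (hae i j) (Nat.cast_nonneg (α := ℝ) n)
    linarith
  calc ∑ c₁ : Codebook U₁ X₁ n, ∑ c₂ : Codebook U₂ X₂ n,
      codebookProb P₁ Q₁ γ₁ c₁ * codebookProb P₂ Q₂ γ₂ c₂ * firstErr P₁ P₂ W c₁ c₂
      = ∑ c₂ : Codebook U₂ X₂ n, codebookProb P₂ Q₂ γ₂ c₂ * ∑ u₂ : Fin n → U₂,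
        ∑ c₁ : Codebook U₁ X₁ n, codebookProb P₁ Q₁ γ₁ c₁ * ∑ u₁ : Fin n → U₁, ∑ y : Fin n → Y,
        competitorLoss (· ≠ ·) (fun u => metric P₁ P₂ W c₁ c₂ y (u, u₂)) u₁ := by
        rw [Finset.sum_comm]
        refine Finset.sum_congr rfl fun c₂ _ => ?_
        rw [Finset.sum_comm, Finset.mul_sum]
        refine Finset.sum_congr rfl fun c₁ _ => ?_
        rw [firstErr, ← Finset.mul_sum]
        ring
    _ ≤ ∑ c₂ : Codebook U₂ X₂ n, codebookProb P₂ Q₂ γ₂ c₂ * ∑ u₂ : Fin n → U₂,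
        (4 * ∑ i, S i (msgClass P₂ γ₂ u₂) ^ (1 + ρ i (msgClass P₂ γ₂ u₂)) * seqProb P₂ u₂ *
        ∑ y, B i (msgClass P₂ γ₂ u₂) (c₂ u₂) y ^ (1 + ρ i (msgClass P₂ γ₂ u₂))) :=
        Finset.sum_le_sum fun c₂ _ => mul_le_mul_of_nonneg_left
          (Finset.sum_le_sum fun u₂ _ => hfix c₂ u₂) (codebookProb_nonneg hQ₂ c₂)
    _ = 4 * ∑ i, ∑ u₂ : Fin n → U₂,
        S i (msgClass P₂ γ₂ u₂) ^ (1 + ρ i (msgClass P₂ γ₂ u₂)) * seqProb P₂ u₂ *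
        ∑ c₂ : Codebook U₂ X₂ n, codebookProb P₂ Q₂ γ₂ c₂ *
        ∑ y, B i (msgClass P₂ γ₂ u₂) (c₂ u₂) y ^ (1 + ρ i (msgClass P₂ γ₂ u₂)) := by
        simp_rw [Finset.mul_sum]
        rw [Finset.sum_comm]
        rw [Finset.sum_comm (s := (Finset.univ : Finset (Fin 2)))]
        refine Finset.sum_congr rfl fun u₂ _ => ?_
        rw [Finset.sum_comm]
        refine Finset.sum_congr rfl fun i _ => Finset.sum_congr rfl fun c₂ _ =>
          Finset.sum_congr rfl fun y _ => ?_
        ring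
    _ = 4 * ∑ i, ∑ u₂ : Fin n → U₂,
        S i (msgClass P₂ γ₂ u₂) ^ (1 + ρ i (msgClass P₂ γ₂ u₂)) * seqProb P₂ u₂ *
        Real.exp (-(n * E0 (ρ i (msgClass P₂ γ₂ u₂)) (Q₁ i)
        (fun (x₁ : X₁) (z : X₂ × Y) => W x₁ z.1 z.2 * Q₂ (msgClass P₂ γ₂ u₂) z.1))) := by
        congr 1
        refine Finset.sum_congr rfl fun i _ => Finset.sum_congr rfl fun u₂ _ => ?_
        rw [← hchan]
        congr 1
        exact sum_prod_mul (q := q₂) hs₂ u₂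
          (fun x₂ => ∑ y, B i (msgClass P₂ γ₂ u₂) x₂ y ^ (1 + ρ i (msgClass P₂ γ₂ u₂)))
    _ = 4 * ∑ i, ∑ j, S i j ^ (1 + ρ i j) *
        (∑ u₂ : Fin n → U₂ with msgClass P₂ γ₂ u₂ = j, seqProb P₂ u₂) *
        Real.exp (-(n * E0 (ρ i j) (Q₁ i)
          (fun (x₁ : X₁) (z : X₂ × Y) => W x₁ z.1 z.2 * Q₂ j z.1))) := by
        congr 1
        refine Finset.sum_congr rfl fun i _ => ?_
        rw [← Finset.sum_fiberwise (s := Finset.univ) (g := msgClass P₂ γ₂)]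
        refine Finset.sum_congr rfl fun j _ => ?_
        rw [Finset.mul_sum, Finset.sum_mul]
        refine Finset.sum_congr rfl fun u₂ hu₂ => ?_
        rw [(Finset.mem_filter.1 hu₂).2]
    _ ≤ 4 * ∑ _i : Fin 2, ∑ _j : Fin 2, Real.exp (-(n * a)) := by
        refine mul_le_mul_of_nonneg_left ?_ (by norm_num)
        exact Finset.sum_le_sum fun i _ => Finset.sum_le_sum fun j _ => hterm i j
    _ = 16 * Real.exp (-(n * a)) := by
        simp only [Finset.sum_const, Finset.card_univ, Fintype.card_fin, nsmul_eq_mul]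
        push_cast
        ring

/-- If both messages are wrong, then both codewords of the competitor are independent of the
transmitted ones, and the two users act as one with the product input distribution. -/
theorem sum_bothErr_le (hP₁ : P₁ ∈ stdSimplex ℝ U₁) (hP₂ : P₂ ∈ stdSimplex ℝ U₂)
    (hQ₁ : ∀ i, Q₁ i ∈ stdSimplex ℝ X₁) (hQ₂ : ∀ i, Q₂ i ∈ stdSimplex ℝ X₂)
    (hW : ∀ x₁ x₂, W x₁ x₂ ∈ stdSimplex ℝ Y) {γ₁ γ₂ a : ℝ} (hγ₁ : 0 ≤ γ₁) (hγ₂ : 0 ≤ γ₂)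
    (ha : ∀ i₁ i₂, (a : EReal) < F P₁ P₂ Q₁ Q₂ W .both i₁ i₂ γ₁ γ₂) (n : ℕ)
    [DecidableEq (Fin n → U₁)] [DecidableEq (Fin n → U₂)] :
    ∑ c₁ : Codebook U₁ X₁ n, ∑ c₂ : Codebook U₂ X₂ n,
      codebookProb P₁ Q₁ γ₁ c₁ * codebookProb P₂ Q₂ γ₂ c₂ * bothErr P₁ P₂ W c₁ c₂
      ≤ 32 * Real.exp (-(n * a)) := by
  have hch : ∀ i : Fin 2 × Fin 2, ∃ ρ ∈ Icc (0 : ℝ) 1, ∃ e₁ e₂ : ℝ, Esi i.1 ρ P₁ γ₁ < e₁ ∧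
      Esi i.2 ρ P₂ γ₂ < e₂ ∧
      a ≤ E0 ρ (fun x : X₁ × X₂ => Q₁ i.1 x.1 * Q₂ i.2 x.2)
          (fun (x : X₁ × X₂) (y : Y) => W x.1 x.2 y) - e₁ - e₂ := by
    intro i
    have h := ha i.1 i.2
    simp only [F, lt_iSup_iff] at h
    obtain ⟨ρ, hρ, h⟩ := h
    refine ⟨ρ, hρ, exists_real_of_lt_sub (Esi_ne_top _ _ _) (Esi_ne_top _ _ _) ?_⟩
    rw [objective, sub_eq_add_neg, EReal.neg_add (Or.inr (Esi_ne_top _ _ _))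
      (Or.inl (Esi_ne_top _ _ _)), sub_eq_add_neg, ← add_assoc, ← sub_eq_add_neg,
      ← sub_eq_add_neg] at h
    exact h
  choose ρ hρ e₁ e₂ he₁ he₂ hae using hch
  set q₁ : (Fin n → U₁) → (Fin n → X₁) → ℝ := fun u => seqProb (Q₁ (msgClass P₁ γ₁ u)) with hq₁
  set q₂ : (Fin n → U₂) → (Fin n → X₂) → ℝ := fun u => seqProb (Q₂ (msgClass P₂ γ₂ u)) with hq₂
  have hs₁ : ∀ u, ∑ x, q₁ u x = 1 := fun u => sum_seqProb (hQ₁ _) n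
  have hs₂ : ∀ u, ∑ x, q₂ u x = 1 := fun u => sum_seqProb (hQ₂ _) n
  have hW0 : ∀ x₁ x₂ y, 0 ≤ W x₁ x₂ y := fun x₁ x₂ => (hW x₁ x₂).1
  set cl : (Fin n → U₁) × (Fin n → U₂) → Fin 2 × Fin 2 := fun u =>
    (msgClass P₁ γ₁ u.1, msgClass P₂ γ₂ u.2) with hcl
  set S₁ : Fin 2 × Fin 2 → ℝ := fun i =>
    ∑ u : Fin n → U₁ with msgClass P₁ γ₁ u = i.1, seqProb P₁ u ^ (1 / (1 + ρ i)) with hS₁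
  set S₂ : Fin 2 × Fin 2 → ℝ := fun i =>
    ∑ u : Fin n → U₂ with msgClass P₂ γ₂ u = i.2, seqProb P₂ u ^ (1 / (1 + ρ i)) with hS₂
  set B : Fin 2 × Fin 2 → (Fin n → Y) → ℝ := fun i y =>
    ∑ x₁ : Fin n → X₁, ∑ x₂ : Fin n → X₂, seqProb (Q₁ i.1) x₁ * seqProb (Q₂ i.2) x₂ *
      chanProb W x₁ x₂ y ^ (1 / (1 + ρ i)) with hB
  have hS₁0 : ∀ i, 0 ≤ S₁ i := fun i => Finset.sum_nonneg fun u _ =>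
    Real.rpow_nonneg (seqProb_nonneg hP₁.1 u) _
  have hS₂0 : ∀ i, 0 ≤ S₂ i := fun i => Finset.sum_nonneg fun u _ =>
    Real.rpow_nonneg (seqProb_nonneg hP₂.1 u) _
  have hB0 : ∀ i y, 0 ≤ B i y := fun i y => Finset.sum_nonneg fun x₁ _ =>
    Finset.sum_nonneg fun x₂ _ => mul_nonneg (mul_nonneg (seqProb_nonneg (hQ₁ _).1 _)
      (seqProb_nonneg (hQ₂ _).1 _)) (Real.rpow_nonneg (chanProb_nonneg hW0 _ _ _) _)
  have key := random_coding_bound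
    (w := fun c : Codebook U₁ X₁ n × Codebook U₂ X₂ n =>
      codebookProb P₁ Q₁ γ₁ c.1 * codebookProb P₂ Q₂ γ₂ c.2)
    (fun c => mul_nonneg (codebookProb_nonneg hQ₁ c.1) (codebookProb_nonneg hQ₂ c.2))
    (m := fun c u y => metric P₁ P₂ W c.1 c.2 y u)
    (fun c u y => metric_nonneg hP₁.1 hP₂.1 hW0 _ _ _ _) cl hρ
    (fun u v => u.1 ≠ v.1 ∧ u.2 ≠ v.2) (fun u v huv y α β => by
      set f : (Fin n → U₁) × (Fin n → U₂) → ℝ → (Fin n → X₁) → (Fin n → X₂) → ℝ := fun u α x₁ x₂ =>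
        (seqProb P₁ u.1 * seqProb P₂ u.2 * chanProb W x₁ x₂ y) ^ α
      have e := sum_sum_prod_mul_mul hs₁ hs₂ huv.1 huv.2 (f u α) (f v β)
      rw [← sum_sum_prod_mul hs₁ hs₂ u.1 u.2 (f u α),
        ← sum_sum_prod_mul hs₁ hs₂ v.1 v.2 (f v β)] at e
      exact e)
  have hA : ∀ i y, ∑ u with cl u = i, ∑ c : Codebook U₁ X₁ n × Codebook U₂ X₂ n,
      codebookProb P₁ Q₁ γ₁ c.1 * codebookProb P₂ Q₂ γ₂ c.2 *
        metric P₁ P₂ W c.1 c.2 y u ^ (1 / (1 + ρ i)) = S₁ i * S₂ i * B i y := by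
    intro i y
    have hfil : (Finset.univ.filter fun u => cl u = i)
        = (Finset.univ.filter fun u => msgClass P₁ γ₁ u = i.1) ×ˢ
          (Finset.univ.filter fun u => msgClass P₂ γ₂ u = i.2) := by
      ext u
      simp [hcl, Prod.ext_iff]
    rw [hfil, Finset.sum_product, hS₁, hS₂, Finset.sum_mul_sum, Finset.sum_mul]
    refine Finset.sum_congr rfl fun u₁ hu₁ => ?_
    rw [Finset.sum_mul]
    refine Finset.sum_congr rfl fun u₂ hu₂ => ?_
    have f1 := sum_sum_prod_mul hs₁ hs₂ u₁ u₂ (fun x₁ x₂ =>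
      (seqProb P₁ u₁ * seqProb P₂ u₂ * chanProb W x₁ x₂ y) ^ (1 / (1 + ρ i)))
    refine Eq.trans f1 ?_
    rw [hB, Finset.mul_sum]
    refine Finset.sum_congr rfl fun x₁ _ => ?_
    rw [Finset.mul_sum]
    refine Finset.sum_congr rfl fun x₂ _ => ?_
    rw [Real.mul_rpow (mul_nonneg (seqProb_nonneg hP₁.1 _) (seqProb_nonneg hP₂.1 _))
      (chanProb_nonneg hW0 _ _ _), Real.mul_rpow (seqProb_nonneg hP₁.1 _)
      (seqProb_nonneg hP₂.1 _), hq₁, hq₂, ← (Finset.mem_filter.1 hu₁).2,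
      ← (Finset.mem_filter.1 hu₂).2]
    ring
  have hchan : ∀ i, ∑ y, B i y ^ (1 + ρ i)
      = Real.exp (-(n * E0 (ρ i) (fun x : X₁ × X₂ => Q₁ i.1 x.1 * Q₂ i.2 x.2)
          (fun (x : X₁ × X₂) (y : Y) => W x.1 x.2 y))) := by
    intro i
    obtain ⟨x₁, hx₁⟩ := exists_pos_of_mem_stdSimplex (hQ₁ i.1)
    obtain ⟨x₂, hx₂⟩ := exists_pos_of_mem_stdSimplex (hQ₂ i.2)
    obtain ⟨y, hy⟩ := exists_pos_of_mem_stdSimplex (hW x₁ x₂)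
    rw [← sum_seq_eq_exp_E0 (Q := fun x : X₁ × X₂ => Q₁ i.1 x.1 * Q₂ i.2 x.2)
      (V := fun (x : X₁ × X₂) (y : Y) => W x.1 x.2 y)
      (fun x => mul_nonneg ((hQ₁ _).1 _) ((hQ₂ _).1 _)) (fun x y => hW0 _ _ _)
      ⟨(x₁, x₂), y, mul_pos hx₁ hx₂, hy⟩]
    refine Finset.sum_congr rfl fun y _ => ?_
    congr 1
    refine (sum_seq_prod fun x₁ x₂ => seqProb (Q₁ i.1) x₁ * seqProb (Q₂ i.2) x₂ *
      chanProb W x₁ x₂ y ^ (1 / (1 + ρ i))).symm.trans ?_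
    refine Finset.sum_congr rfl fun x _ => ?_
    simp only [seqProb, chanProb, Finset.prod_mul_distrib]
  have hterm : ∀ i, ∑ y, (S₁ i * S₂ i * B i y) ^ (1 + ρ i) ≤ Real.exp (-(n * a)) := by
    intro i
    have h1 := class_sum_le hP₁ (hρ i).1 hγ₁ (he₁ i) n
    have h2 := class_sum_le hP₂ (hρ i).1 hγ₂ (he₂ i) n
    have e : ∑ y, (S₁ i * S₂ i * B i y) ^ (1 + ρ i)
        = S₁ i ^ (1 + ρ i) * S₂ i ^ (1 + ρ i) * ∑ y, B i y ^ (1 + ρ i) := by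
      rw [Finset.mul_sum (Finset.univ : Finset (Fin n → Y))]
      refine Finset.sum_congr rfl fun y _ => ?_
      rw [Real.mul_rpow (mul_nonneg (hS₁0 i) (hS₂0 i)) (hB0 i y), Real.mul_rpow (hS₁0 i) (hS₂0 i)]
    rw [e, hchan]
    refine (mul_le_mul_of_nonneg_right (mul_le_mul h1 h2 (Real.rpow_nonneg (hS₂0 i) _)
      (Real.exp_nonneg _)) (Real.exp_nonneg _)).trans ?_
    rw [← Real.exp_add, ← Real.exp_add]
    refine Real.exp_le_exp.2 ?_
    have := mul_le_mul_of_nonneg_left (hae i) (Nat.cast_nonneg (α := ℝ) n)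
    linarith
  rw [← Fintype.sum_prod_type']
  refine key.trans ?_
  simp_rw [hA]
  refine (mul_le_mul_of_nonneg_left (Finset.sum_le_sum fun i _ => hterm i) (by positivity)).trans ?_
  simp only [Finset.sum_const, Finset.card_univ, Fintype.card_prod, Fintype.card_fin, nsmul_eq_mul]
  push_cast
  linarith

/-- Every real number below the exponent of the thresholds `γ₁`, `γ₂` is an exponential rate of
decay of the average error probability. -/
theorem avgErrorProb_le (hP₁ : P₁ ∈ stdSimplex ℝ U₁) (hP₂ : P₂ ∈ stdSimplex ℝ U₂)
    (hQ₁ : ∀ i, Q₁ i ∈ stdSimplex ℝ X₁) (hQ₂ : ∀ i, Q₂ i ∈ stdSimplex ℝ X₂)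
    (hW : ∀ x₁ x₂, W x₁ x₂ ∈ stdSimplex ℝ Y) {γ₁ γ₂ a : ℝ} (hγ₁ : 0 ≤ γ₁) (hγ₂ : 0 ≤ γ₂)
    (ha : (a : EReal) < thresholdExponent P₁ P₂ Q₁ Q₂ W γ₁ γ₂) {n : ℕ}
    {d : Codebook U₁ X₁ n → Codebook U₂ X₂ n → Decoder U₁ U₂ Y n}
    (hd : ∀ c₁ c₂, IsMAP P₁ P₂ W c₁ c₂ (d c₁ c₂)) :
    avgErrorProb P₁ P₂ Q₁ Q₂ W γ₁ γ₂ d ≤ 64 * Real.exp (-(n * a)) := by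
  classical
  have hF : ∀ τ i₁ i₂, (a : EReal) < F P₁ P₂ Q₁ Q₂ W τ i₁ i₂ γ₁ γ₂ := fun τ i₁ i₂ =>
    ha.trans_le (iInf_le_of_le τ (iInf_le_of_le i₁ (iInf_le _ i₂)))
  have h1 := sum_firstErr_le hP₁ hP₂ hQ₁ hQ₂ hW hγ₁ hγ₂ (hF .first) n
  have h2 := sum_firstErr_le (W := fun x₂ x₁ => W x₁ x₂) hP₂ hP₁ hQ₂ hQ₁ (fun x₂ x₁ => hW x₁ x₂)
    hγ₂ hγ₁ (fun i₂ i₁ => hF .second i₁ i₂) n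
  have h3 := sum_bothErr_le hP₁ hP₂ hQ₁ hQ₂ hW hγ₁ hγ₂ (hF .both) n
  rw [Finset.sum_comm] at h2
  have h : avgErrorProb P₁ P₂ Q₁ Q₂ W γ₁ γ₂ d ≤
      ∑ c₁ : Codebook U₁ X₁ n, ∑ c₂ : Codebook U₂ X₂ n,
        (codebookProb P₁ Q₁ γ₁ c₁ * codebookProb P₂ Q₂ γ₂ c₂ * firstErr P₁ P₂ W c₁ c₂
        + codebookProb P₂ Q₂ γ₂ c₂ * codebookProb P₁ Q₁ γ₁ c₁ *
          firstErr P₂ P₁ (fun x₂ x₁ => W x₁ x₂) c₂ c₁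
        + codebookProb P₁ Q₁ γ₁ c₁ * codebookProb P₂ Q₂ γ₂ c₂ * bothErr P₁ P₂ W c₁ c₂) := by
    unfold avgErrorProb
    refine le_trans (le_of_eq ?_) (Finset.sum_le_sum fun c₁ _ => Finset.sum_le_sum fun c₂ _ =>
      (mul_le_mul_of_nonneg_left (errorProb_le hP₁.1 hP₂.1 (fun x₁ x₂ => (hW x₁ x₂).1) (hd c₁ c₂))
        (mul_nonneg (codebookProb_nonneg hQ₁ c₁) (codebookProb_nonneg hQ₂ c₂))).trans
          (le_of_eq (by ring)))
    congr!
  refine h.trans ?_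
  simp only [Finset.sum_add_distrib]
  linarith

/-! ### From error bounds to exponents -/

theorem decay_anti (n : ℕ) {ε ε' : ℝ} (h : ε ≤ ε') : decay n ε' ≤ decay n ε :=
  EReal.div_le_div_right_of_nonneg (by positivity)
    (EReal.neg_le_neg_iff.2 (ENNReal.log_monotone (ENNReal.ofReal_le_ofReal h)))

theorem decay_exp {C : ℝ} (hC : 0 < C) (a : ℝ) {n : ℕ} (hn : n ≠ 0) :
    decay n (C * Real.exp (-(n * a))) = ((a - Real.log C / n : ℝ) : EReal) := by
  have hn' : (n : ℝ) ≠ 0 := Nat.cast_ne_zero.2 hn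
  rw [decay, ENNReal.log_ofReal_of_pos (mul_pos hC (Real.exp_pos _)),
    Real.log_mul hC.ne' (Real.exp_ne_zero _), Real.log_exp]
  have : ((n : ℕ) : EReal) = ((n : ℝ) : EReal) := rfl
  rw [this, ← EReal.coe_neg, ← EReal.coe_div]
  congr 1
  field_simp
  ring

theorem le_liminf_decay {E : EReal} {C : ℝ} (hC : 0 < C) {ε : ℕ → ℝ}
    (h : ∀ a : ℝ, (a : EReal) < E → ∀ n : ℕ, ε n ≤ C * Real.exp (-(n * a))) :
    E ≤ liminf (fun n => decay n (ε n)) atTop := by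
  refine EReal.ge_of_forall_gt_iff_ge.1 fun a ha => ?_
  have hlim : Tendsto (fun n : ℕ => ((a - Real.log C / n : ℝ) : EReal)) atTop
      (nhds (a : EReal)) := by
    refine (continuous_coe_real_ereal.tendsto a).comp ?_
    simpa using tendsto_const_nhds.sub (tendsto_const_div_atTop_nhds_zero_nat (Real.log C))
  rw [← hlim.liminf_eq]
  refine liminf_le_liminf ?_
  filter_upwards [eventually_ne_atTop 0] with n hn
  rw [← decay_exp hC a hn]
  exact decay_anti n (h a ha n)

theorem exists_le_weighted_sum {ι : Type*} [Fintype ι] {w : ι → ℝ} (hw : ∀ i, 0 ≤ w i)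
    (hw1 : ∑ i, w i = 1) (f : ι → ℝ) : ∃ i, f i ≤ ∑ i, w i * f i := by
  by_contra! h
  set m := ∑ i, w i * f i
  have h0 : ∑ i, w i * (f i - m) = 0 := by
    simp only [mul_sub, Finset.sum_sub_distrib, ← Finset.sum_mul, hw1, one_mul]
    exact sub_self m
  have h1 := (Finset.sum_eq_zero_iff_of_nonneg fun i _ =>
    mul_nonneg (hw i) (sub_nonneg.2 (h i).le)).1 h0
  have h2 : ∀ i, w i = 0 := fun i =>
    (mul_eq_zero.1 (h1 i (Finset.mem_univ i))).resolve_right (sub_pos.2 (h i)).ne'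
  simp [h2] at hw1

theorem exists_codebooks_le_avg (hQ₁ : ∀ i, Q₁ i ∈ stdSimplex ℝ X₁)
    (hQ₂ : ∀ i, Q₂ i ∈ stdSimplex ℝ X₂) (γ₁ γ₂ : ℝ) {n : ℕ}
    (d : Codebook U₁ X₁ n → Codebook U₂ X₂ n → Decoder U₁ U₂ Y n) :
    ∃ c₁ c₂, errorProb P₁ P₂ W c₁ c₂ (d c₁ c₂) ≤ avgErrorProb P₁ P₂ Q₁ Q₂ W γ₁ γ₂ d := by
  classical
  obtain ⟨c, hc⟩ := exists_le_weighted_sum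
    (w := fun c : Codebook U₁ X₁ n × Codebook U₂ X₂ n =>
      codebookProb P₁ Q₁ γ₁ c.1 * codebookProb P₂ Q₂ γ₂ c.2)
    (fun c => mul_nonneg (codebookProb_nonneg hQ₁ c.1) (codebookProb_nonneg hQ₂ c.2))
    (by
      rw [Fintype.sum_prod_type]
      simp_rw [← Finset.mul_sum]
      rw [← Finset.sum_mul]
      have h₁ := sum_prod_eq_one (q := fun u : Fin n → U₁ =>
        (seqProb (Q₁ (msgClass P₁ γ₁ u)) : (Fin n → X₁) → ℝ)) fun u => sum_seqProb (hQ₁ _) n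
      have h₂ := sum_prod_eq_one (q := fun u : Fin n → U₂ =>
        (seqProb (Q₂ (msgClass P₂ γ₂ u)) : (Fin n → X₂) → ℝ)) fun u => sum_seqProb (hQ₂ _) n
      exact (congrArg₂ (· * ·) h₁ h₂).trans (one_mul 1))
    (fun c => errorProb P₁ P₂ W c.1 c.2 (d c.1 c.2))
  refine ⟨c.1, c.2, hc.trans (le_of_eq ?_)⟩
  rw [Fintype.sum_prod_type, avgErrorProb]

end ensemble

end MAC

end

theorem proposition1 {U₁ U₂ X₁ X₂ Y : Type*}
    [Fintype U₁] [Fintype U₂] [Fintype X₁] [Fintype X₂] [Fintype Y]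
    (P₁ : U₁ → ℝ) (hP₁ : P₁ ∈ stdSimplex ℝ U₁)
    (P₂ : U₂ → ℝ) (hP₂ : P₂ ∈ stdSimplex ℝ U₂)
    (Q₁ : Fin 2 → X₁ → ℝ) (hQ₁ : ∀ i, Q₁ i ∈ stdSimplex ℝ X₁)
    (Q₂ : Fin 2 → X₂ → ℝ) (hQ₂ : ∀ i, Q₂ i ∈ stdSimplex ℝ X₂)
    (W : X₁ → X₂ → Y → ℝ) (hW : ∀ x₁ x₂, W x₁ x₂ ∈ stdSimplex ℝ Y) :
    (∀ (τ : MAC.ErrType) (i₁ i₂ : Fin 2), ∀ γ₁ ∈ Set.Icc (0 : ℝ) 1, ∀ γ₂ ∈ Set.Icc (0 : ℝ) 1,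
      ∃ ρ ∈ Set.Icc (0 : ℝ) 1,
        MAC.objective P₁ P₂ Q₁ Q₂ W τ i₁ i₂ γ₁ γ₂ ρ = MAC.F P₁ P₂ Q₁ Q₂ W τ i₁ i₂ γ₁ γ₂) ∧
    (∃ γ₁ ∈ Set.Icc (0 : ℝ) 1, ∃ γ₂ ∈ Set.Icc (0 : ℝ) 1,
      MAC.thresholdExponent P₁ P₂ Q₁ Q₂ W γ₁ γ₂ = MAC.exponent P₁ P₂ Q₁ Q₂ W) ∧
    (∀ γ₁ ∈ Set.Icc (0 : ℝ) 1, ∀ γ₂ ∈ Set.Icc (0 : ℝ) 1,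
      ∀ d : ∀ n, MAC.Codebook U₁ X₁ n → MAC.Codebook U₂ X₂ n → MAC.Decoder U₁ U₂ Y n,
        (∀ n c₁ c₂, MAC.IsMAP P₁ P₂ W c₁ c₂ (d n c₁ c₂)) →
        MAC.thresholdExponent P₁ P₂ Q₁ Q₂ W γ₁ γ₂ ≤
          Filter.liminf (fun n : ℕ =>
            MAC.decay n (MAC.avgErrorProb P₁ P₂ Q₁ Q₂ W γ₁ γ₂ (d n))) Filter.atTop) ∧
    MAC.IsAchievable P₁ P₂ W (MAC.exponent P₁ P₂ Q₁ Q₂ W) := by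
  have hens : ∀ γ₁ ∈ Set.Icc (0 : ℝ) 1, ∀ γ₂ ∈ Set.Icc (0 : ℝ) 1,
      ∀ d : ∀ n, MAC.Codebook U₁ X₁ n → MAC.Codebook U₂ X₂ n → MAC.Decoder U₁ U₂ Y n,
        (∀ n c₁ c₂, MAC.IsMAP P₁ P₂ W c₁ c₂ (d n c₁ c₂)) →
        MAC.thresholdExponent P₁ P₂ Q₁ Q₂ W γ₁ γ₂ ≤
          Filter.liminf (fun n : ℕ =>
            MAC.decay n (MAC.avgErrorProb P₁ P₂ Q₁ Q₂ W γ₁ γ₂ (d n))) Filter.atTop :=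
    fun γ₁ hγ₁ γ₂ hγ₂ d hd => MAC.le_liminf_decay (by norm_num) fun a ha n =>
      MAC.avgErrorProb_le hP₁ hP₂ hQ₁ hQ₂ hW hγ₁.1 hγ₂.1 ha (hd n)
  have hopt := MAC.exists_thresholdExponent_eq hP₁ hP₂ hQ₁ hQ₂ hW
  refine ⟨fun τ i₁ i₂ γ₁ hγ₁ γ₂ hγ₂ =>
    MAC.exists_objective_eq_F hP₁ hP₂ hQ₁ hQ₂ hW τ i₁ i₂ hγ₁ hγ₂, hopt, hens, ?_⟩
  obtain ⟨γ₁, hγ₁, γ₂, hγ₂, hE⟩ := hopt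
  have : Nonempty U₁ := (MAC.supp_nonempty hP₁).to_type
  have : Nonempty U₂ := (MAC.supp_nonempty hP₂).to_type
  choose d hd using fun (n : ℕ) (c₁ : MAC.Codebook U₁ X₁ n) (c₂ : MAC.Codebook U₂ X₂ n) =>
    MAC.exists_isMAP P₁ P₂ W c₁ c₂
  choose c₁ c₂ hc using fun n => MAC.exists_codebooks_le_avg (P₁ := P₁) (P₂ := P₂) (W := W)
    hQ₁ hQ₂ γ₁ γ₂ (d n)
  refine ⟨c₁, c₂, fun d' hd' => hE ▸ (hens γ₁ hγ₁ γ₂ hγ₂ d hd).trans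
    (Filter.liminf_le_liminf (Filter.Eventually.of_forall fun n => MAC.decay_anti n ?_))⟩
  rw [MAC.errorProb_eq_of_isMAP (hd' n) (hd n (c₁ n) (c₂ n))]
  exact hc n
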